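/- **Setting.** Let $\mathcal X$ be a measurable space and let $\mathcal F$ be a nonempty class of measurable classifiers $f:\mathcal X\to\{0,1\}$ of VC dimension $d<\infty$. There are $k\ge 1$ players with probability distributions $D_1,\dots,D_k$ on $\mathcal X\times\{0,1\}$. Write $\mathrm{err}_D(f)=\Pr_{(x,y)\sim D}[f(x)\ne y]$, let $\mathrm{err}_S(f)$ be the fraction of a finite sample $S$ that $f$ mislabels, and let $\mathrm{OPT}=\inf_{f\in\mathcal F}\max_{i\in[k]}\mathrm{err}_{D_i}(f)$. Let $\mathcal O_{\mathcal F}$ be an empirical risk minimizer: it maps each finite sample $S$ to some $\mathcal O_{\mathcal F}(S)\in\mathcal F$ with $\mathrm{err}_S(\mathcal O_{\mathcal F}(S))=\min_{f\in\mathcal F}\mathrm{err}_S(f)$, and $(S,x)\mapsto\mathcal O_{\mathcal F}(S)(x)$ is measurable on samples of each fixed size. **Algorithm NR2-AVG** (with constants $c_S,c_T$). Put $\alpha'=\alpha/15$, $\epsilon'=\epsilon/29$, $t=2\lceil \ln(4k/\delta)/(\epsilon'\alpha'^2)\rceil$, $\delta'=\delta/(4t)$, and $w_i^{(0)}=1$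 for $i\in[k]$. In each round $r=1,\dots,t$: - draw a sample $S^{(r)}$ of size $\big\lceil \frac{c_S}{\alpha'\epsilon'}\big(d\ln\frac1{\epsilon'}+\ln\frac1{\delta'}\big)\big\rceil$ from the mixture $\sum_i w_i^{(r-1)}D_i\big/\sum_i w_i^{(r-1)}$; - let $f^{(r)}=\mathcal O_{\mathcal F}(S^{(r)})$; - for each $i\in[k]$, draw a sample $T_i$ of size $\big\lceil\frac{c_T}{\alpha'\epsilon'}\ln\frac1{\epsilon'}\big\rceil$ from $D_i$, and set $w_i^{(r)}=w_i^{(r-1)}(1+s_i^{(r)})$ with $$s_i^{(r)}=\frac{\mathrm{err}_{T_i}(f^{(r)})\,\epsilon'\alpha'}{(1+3\alpha')\,\mathrm{err}_{S^{(r)}}(f^{(r)})+3\epsilon'}.$$ Output the randomized classifier $f_{\text{NR2-AVG}}$ that, given $x$, picks $r\in[t]$ uniformly at random and returns $f^{(r)}(x)$. Its expected error $\overline{\mathrm{err}}_{D}(f_{\text{NR2-AVG}})$ is the probability of a wrong label over both $(x,y)\sim D$ and the choice of $r$. **Theorem.** There is a universal constant $c_0>0$ such that for all constants $c_S,c_T\ge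 c_0$ there is a constant $K$, depending only on $c_S$ and $c_T$, for which the following holds. For all $\epsilon,\delta\in(0,1)$ and $30\epsilon/29<\alpha<1$, and all $\mathcal X,\mathcal F,d,k,D_1,\dots,D_k,\mathcal O_{\mathcal F}$ as above, with probability at least $1-\delta$ over the samples drawn, $$\overline{\mathrm{err}}_{D_i}(f_{\text{NR2-AVG}})\le(1+\alpha)\,\mathrm{OPT}+\epsilon\qquad\text{for all } i\in[k].$$ Moreover, if $k\ge 2\delta$ (that is, unless $k=1$ and $\delta>1/2$), the total number $m$ of samples drawn satisfies $$m\le K\cdot\frac{1}{\alpha^3\epsilon^2}\ln\Big(\frac k\delta\Big)\Big((d+k)\ln\Big(\frac1\epsilon\Big)+\ln\Big(\frac1\delta\Big)\Big).$$ -/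

import Mathlib

open MeasureTheory ProbabilityTheory

noncomputable section

namespace CollabPAC

/-- Labelled samples of size `n` (ordered, repetitions allowed). -/
abbrev Sample (X : Type*) (n : ℕ) : Type _ := Fin n → X × Bool

/-- `err_D(f) = Pr_{(x,y) ∼ D} [f x ≠ y]`. -/
def err {X : Type*} [MeasurableSpace X] (D : Measure (X × Bool)) (f : X → Bool) : ℝ :=
  D.real {z | f z.1 ≠ z.2}

/-- `err_S(f)`: the fraction of the sample points that `f` mislabels. -/
def empErr {X : Type*} {n : ℕ} (S : Sample X n) (f : X → Bool) : ℝ :=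
  ((Finset.univ.filter fun j => f (S j).1 ≠ (S j).2).card : ℝ) / n

/-- `OPT = inf_{f ∈ F} max_{i} err_{D_i}(f)`. -/
def opt {X : Type*} [MeasurableSpace X] {k : ℕ} (D : Fin k → Measure (X × Bool))
    (F : Set (X → Bool)) : ℝ :=
  ⨅ f : F, ⨆ i : Fin k, err (D i) f

/-- `F` realises every labelling of the finite set `s`. -/
def Shatters {X : Type*} (F : Set (X → Bool)) (s : Finset X) : Prop :=
  ∀ g : X → Bool, ∃ f ∈ F, ∀ x ∈ s, f x = g x

/-- VC dimension: the supremum of the sizes of the finite sets shattered by `F`. -/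
def vcDim {X : Type*} (F : Set (X → Bool)) : ℕ∞ :=
  ⨆ s : {s : Finset X // Shatters F s}, (s.1.card : ℕ∞)

/-- `O` maps every sample to a member of `F` with minimal error on that sample. -/
def IsERM {X : Type*} (F : Set (X → Bool)) (O : ∀ n : ℕ, Sample X n → X → Bool) : Prop :=
  ∀ (n : ℕ) (S : Sample X n), O n S ∈ F ∧ ∀ f ∈ F, empErr S (O n S) ≤ empErr S f

/-- The samples drawn in one round: `S` (of size `nS`) from the weighted mixture, and, for each
of the `k` players, `T i` (of size `nT`) from the distribution of player `i`. -/
abbrev RoundData (X : Type*) (k nS nT : ℕ) : Type _ := Sample X nS × (Fin k → Sample X nT)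

/-- The weighted mixture `(1 / ∑ i, w i) • ∑ i, w i • D i`. -/
def mixture {X : Type*} [MeasurableSpace X] {k : ℕ} (D : Fin k → Measure (X × Bool))
    (w : Fin k → ℝ) : Measure (X × Bool) :=
  ∑ i, ENNReal.ofReal (w i / ∑ j, w j) • D i

section Algorithm

variable {X : Type*} {k nS nT : ℕ}

/-- The classifier of a round: the oracle applied to the sample from the mixture. -/
def roundClassifier (O : ∀ n : ℕ, Sample X n → X → Bool) (ρ : RoundData X k nS nT) : X → Bool :=
  O nS ρ.1

/-- The increment `s_i` of a round, where `a = α'` and `e = ε'`. -/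
def increment (O : ∀ n : ℕ, Sample X n → X → Bool) (a e : ℝ) (ρ : RoundData X k nS nT)
    (i : Fin k) : ℝ :=
  empErr (ρ.2 i) (roundClassifier O ρ) * e * a /
    ((1 + 3 * a) * empErr ρ.1 (roundClassifier O ρ) + 3 * e)

/-- The weights after the rounds recorded in `h`. -/
def weight (O : ∀ n : ℕ, Sample X n → X → Bool) (a e : ℝ) :
    (r : ℕ) → (Fin r → RoundData X k nS nT) → Fin k → ℝ
  | 0, _, _ => 1
  | r + 1, h, i => weight O a e r (Fin.init h) i * (1 + increment O a e (h (Fin.last r)) i)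

variable [MeasurableSpace X]

/-- The law of the samples of the next round, given the rounds recorded in `h`: all samples are
independent, those in `S` are drawn from the mixture with the current weights, and those in `T i`
are drawn from `D i`. -/
def roundLaw (D : Fin k → Measure (X × Bool)) (O : ∀ n : ℕ, Sample X n → X → Bool) (a e : ℝ)
    (r : ℕ) (h : Fin r → RoundData X k nS nT) : Measure (RoundData X k nS nT) :=
  (Measure.pi fun _ : Fin nS => mixture D (weight O a e r h)).prod
    (Measure.pi fun i : Fin k => Measure.pi fun _ : Fin nT => D i)

/-- The joint law of the samples drawn in the first `r` rounds. -/
def runLaw (D : Fin k → Measure (X × Bool)) (O : ∀ n : ℕ, Sample X n → X → Bool) (a e : ℝ) :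
    (r : ℕ) → Measure (Fin r → RoundData X k nS nT)
  | 0 => Measure.dirac Fin.elim0
  | r + 1 => (runLaw D O a e r).bind fun h =>
      (roundLaw D O a e r h).map fun ρ => Fin.snoc (α := fun _ => RoundData X k nS nT) h ρ

end Algorithm

/-- The randomized classifier that, given `x`, picks one of `f 0, …, f (t - 1)` uniformly at
random and returns its label of `x`: the value at `x` is the law of the returned label. -/
def mixClassifier {X : Type*} {t : ℕ} (f : Fin t → X → Bool) (x : X) : Measure Bool :=
  (uniformOn (Set.univ : Set (Fin t))).map fun r => f r x

/-- The error probability of a randomized classifier `g`, over both the random example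
`(x, y) ∼ D` and the random label drawn from `g x`. -/
def expectedErr {X : Type*} [MeasurableSpace X] (D : Measure (X × Bool)) (g : X → Measure Bool) :
    ℝ :=
  (∫⁻ z, g z.1 {b | b ≠ z.2} ∂D).toReal

/-- `α' = α / 15`. -/
def innerAlpha (α : ℝ) : ℝ := α / 15

/-- `ε' = ε / 29`. -/
def innerEps (ε : ℝ) : ℝ := ε / 29

/-- The number of rounds `t = 2 ⌈ln (4 k / δ) / (ε' α' ^ 2)⌉`. -/
def rounds (k : ℕ) (α ε δ : ℝ) : ℕ :=
  2 * ⌈Real.log (4 * k / δ) / (innerEps ε * innerAlpha α ^ 2)⌉₊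

/-- `δ' = δ / (4 t)`. -/
def innerDelta (k : ℕ) (α ε δ : ℝ) : ℝ := δ / (4 * rounds k α ε δ)

/-- The size `(c / (α' ε')) (d ln (1 / ε') + ln (1 / δ'))` of the sample from the mixture. -/
def sizeS (c : ℝ) (d k : ℕ) (α ε δ : ℝ) : ℕ :=
  ⌈c / (innerAlpha α * innerEps ε) *
    (d * Real.log (1 / innerEps ε) + Real.log (1 / innerDelta k α ε δ))⌉₊

/-- The size `(c / (α' ε')) ln (1 / ε')` of the sample from each player. -/
def sizeT (c : ℝ) (α ε : ℝ) : ℕ :=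
  ⌈c / (innerAlpha α * innerEps ε) * Real.log (1 / innerEps ε)⌉₊

/-- The records of the complete runs of the algorithm (`cS` and `cT` are the constants in the
sizes of the samples). -/
abbrev Run (X : Type*) (cS cT : ℝ) (d k : ℕ) (α ε δ : ℝ) : Type _ :=
  Fin (rounds k α ε δ) → RoundData X k (sizeS cS d k α ε δ) (sizeT cT α ε)

/-- The law of a complete run of NR2-AVG. -/
def nr2avgLaw {X : Type*} [MeasurableSpace X] {k : ℕ} (D : Fin k → Measure (X × Bool))
    (O : ∀ n : ℕ, Sample X n → X → Bool) (cS cT : ℝ) (d : ℕ) (α ε δ : ℝ) :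
    Measure (Run X cS cT d k α ε δ) :=
  runLaw D O (innerAlpha α) (innerEps ε) (rounds k α ε δ)

/-- The randomized classifier that NR2-AVG returns at the end of a run. -/
def nr2avgOutput {X : Type*} {k d : ℕ} {cS cT α ε δ : ℝ} (O : ∀ n : ℕ, Sample X n → X → Bool)
    (h : Run X cS cT d k α ε δ) : X → Measure Bool :=
  mixClassifier fun r => roundClassifier O (h r)

/-- The number of samples that NR2-AVG draws: in each round one sample from the mixture and one
from each of the `k` players. -/
def nr2avgSamples (cS cT : ℝ) (d k : ℕ) (α ε δ : ℝ) : ℕ :=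
  rounds k α ε δ * (sizeS cS d k α ε δ + k * sizeT cT α ε)

end CollabPAC

end

open CollabPAC

open CollabPAC

/-! ### The growth function of a class of bounded VC dimension -/

/-! The argument is multiplicative weights with two exponential potentials. Write `a = α'`, `e =
ε'`, and let the slack of a round be the denominator of its increments.

Call a round accurate if the error of its classifier on the current mixture is at most the slack and
its empirical error is at most `θ = (1 + a)(OPT + e) + e`. The first condition is relative uniform
convergence (`measureReal_err_gt_le`): a ghost sample, random swaps of the two halves, and the
Sauer-Shelah bound on the number of traces. The second compares the minimizer with one fixed
near-optimal classifier, whose error on every mixture is at most `OPT + e`. The samples are large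
enough for all rounds to be accurate except with probability `2 t δ' = δ / 2` (`round_failure_le`).

In an accurate round the weighted mean of the errors of the players is at most the slack, so the
expected total weight grows by a factor of at most `1 + e a`. Markov's inequality bounds the final
total weight (`lintegral_indicator_sum_weight_le`). In the other direction, `(1 + s)⁻¹ ≤ 1 - (1 -
a/3) s` for `0 ≤ s ≤ a/3` makes `∏ (1 + s)⁻¹ exp ((1 - a/3) E s)` a supermartingale, so a player
with large errors has a large weight (`lintegral_prod_inv_one_add_increment_le`). This uses only
that the error on `T_i` is unbiased, so no concentration for the samples `T_i` is needed.

One weight is at most the total weight, and comparing logarithms bounds the sum of the errors of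
each player (`average_err_le`). With `M = 4k / δ`, each of the two Markov steps fails with
probability at most `k / M = δ / 4`. The choice of `t` makes `log M` at most `e a² t / 2`, and the
loss is then a factor `1 + O(a)` and a term `O(e)`, which `error_bound_le` fits into `15 a` and `29
e`. -/

theorem exists_traces_card_le {X ι : Type*} [Fintype ι] [DecidableEq ι] {F : Set (X → Bool)}
    {d : ℕ} (hd : vcDim F ≤ d) (z : ι → X) :
    ∃ R : Finset (ι → Bool), (∀ f ∈ F, (fun i => f (z i)) ∈ R) ∧
      R.card ≤ ∑ i ∈ Finset.Iic d, (Fintype.card ι).choose i := by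
  classical
  let tr : (ι → Bool) → Finset ι := fun b => Finset.univ.filter fun i => b i = true
  have htr : Function.Injective tr := by
    intro b b' h
    funext i
    have := Finset.ext_iff.1 h i
    simp only [tr, Finset.mem_filter, Finset.mem_univ, true_and] at this
    exact Bool.eq_iff_iff.2 this
  let R : Finset (ι → Bool) := Finset.univ.filter fun b => ∃ f ∈ F, b = fun i => f (z i)
  refine ⟨R, fun f hf => by simpa [R] using ⟨f, hf, rfl⟩, ?_⟩
  -- Index sets shattered by the traces correspond to point sets shattered by `F`, so the
  -- Sauer-Shelah bound for finite set families can be applied to the traces.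
  have hshat : ∀ s : Finset ι, (R.image tr).Shatters s → s.card ≤ d := by
    intro s hs
    have key : ∀ t ⊆ s, ∃ f ∈ F, ∀ i ∈ s, (f (z i) = true ↔ i ∈ t) := by
      intro t ht
      obtain ⟨u, hu, hsu⟩ := hs ht
      simp only [Finset.mem_image, R, Finset.mem_filter, Finset.mem_univ, true_and] at hu
      obtain ⟨b, ⟨f, hf, rfl⟩, rfl⟩ := hu
      refine ⟨f, hf, fun i hi => ?_⟩
      rw [← hsu]
      simp [tr, hi]
    -- `z` may repeat points, but two indices with the same point are never separated by a trace, so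
    -- a shattered set contains no repetition.
    have hinj : Set.InjOn z s := by
      intro i hi j hj hij
      obtain ⟨f, -, h⟩ := key {i} (by simpa using hi)
      have h1 := (h i hi).2 (by simp)
      rw [hij] at h1
      have := (h j hj).1 h1
      exact (by simpa using this : j = i).symm
    have hS : Shatters F (s.image z) := by
      intro g
      obtain ⟨f, hf, h⟩ := key (s.filter fun i => g (z i) = true) (Finset.filter_subset _ _)
      refine ⟨f, hf, ?_⟩
      intro x hx
      obtain ⟨i, hi, rfl⟩ := Finset.mem_image.1 hx
      have := h i hi
      simp only [Finset.mem_filter, hi, true_and] at this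
      exact Bool.eq_iff_iff.2 this
    have h1 : ((s.image z).card : ℕ∞) ≤ vcDim F :=
      le_iSup (fun s : {s : Finset X // Shatters F s} => (s.1.card : ℕ∞)) ⟨s.image z, hS⟩
    rw [Finset.card_image_of_injOn hinj] at h1
    exact_mod_cast h1.trans hd
  have hvc : (R.image tr).vcDim ≤ d :=
    Finset.sup_le fun s hs => hshat s (Finset.mem_shatterer.1 hs)
  calc R.card = (R.image tr).card := (Finset.card_image_of_injective _ htr).symm
    _ ≤ (R.image tr).shatterer.card := Finset.card_le_card_shatterer _
    _ ≤ ∑ i ∈ Finset.Iic (R.image tr).vcDim, (Fintype.card ι).choose i :=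
        Finset.card_shatterer_le_sum_vcDim
    _ ≤ _ := Finset.sum_le_sum_of_subset (Finset.Iic_subset_Iic.2 hvc)

/-- Multiply by `x ^ d ≤ x ^ i` and complete the sum to the binomial expansion of `(1 + x) ^ m`. The
free `x` lets the growth in `m` be absorbed into any exponentially small factor, without optimizing
in `m / d`. -/
theorem sum_choose_le_exp (d m : ℕ) {x : ℝ} (hx : 0 < x) (hx1 : x ≤ 1) :
    (∑ i ∈ Finset.Iic d, (m.choose i : ℝ)) ≤ (1 / x) ^ d * Real.exp (x * m) := by
  have h1 : x ^ d * ∑ i ∈ Finset.Iic d, (m.choose i : ℝ) ≤ (x + 1) ^ m := by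
    rw [add_pow, Finset.mul_sum]
    simp only [one_pow, mul_one]
    calc ∑ i ∈ Finset.Iic d, x ^ d * (m.choose i : ℝ)
        ≤ ∑ i ∈ Finset.Iic d, x ^ i * (m.choose i : ℝ) := by
          refine Finset.sum_le_sum fun i hi => ?_
          gcongr ?_ * _
          exact pow_le_pow_of_le_one hx.le hx1 (Finset.mem_Iic.1 hi)
      _ ≤ ∑ i ∈ Finset.Iic d ∪ Finset.range (m + 1), x ^ i * (m.choose i : ℝ) :=
          Finset.sum_le_sum_of_subset_of_nonneg Finset.subset_union_left
            fun _ _ _ => by positivity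
      _ = ∑ i ∈ Finset.range (m + 1), x ^ i * (m.choose i : ℝ) := by
          symm
          refine Finset.sum_subset Finset.subset_union_right fun i _ hi => ?_
          rw [Nat.choose_eq_zero_of_lt (by simpa using hi)]
          simp
  have h2 : (x + 1) ^ m ≤ Real.exp (x * m) := by
    rw [mul_comm, Real.exp_nat_mul]
    exact pow_le_pow_left₀ (by positivity) (Real.add_one_le_exp x) m
  rw [one_div, inv_pow, inv_mul_eq_div, le_div_iff₀ (by positivity), mul_comm]
  exact h1.trans h2

/-! ### Random swaps -/

/-- Twice the exponential moment of one randomly ordered pair. For `u ≠ v` the linear terms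
contribute `-a² / 4` and the quadratic remainders at most `(1 + (1 + a)²) a² / 16`, which is no more
as long as `(1 + a)² ≤ 3`. The factor `1 + a` supplies the negative drift. -/
theorem swap_factor_le {a u v : ℝ} (ha : 0 < a) (ha1 : a ≤ 2 / 5) (hu : u = 0 ∨ u = 1)
    (hv : v = 0 ∨ v = 1) :
    Real.exp (a / 4 * (u - (1 + a) * v)) + Real.exp (a / 4 * (v - (1 + a) * u)) ≤ 2 := by
  have key : Real.exp (a / 4) + Real.exp (a / 4 * (-(1 + a))) ≤ 2 := by
    have h1 := (abs_le.1 (Real.abs_exp_sub_one_sub_id_le (x := a / 4)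
      (by rw [abs_of_pos (by positivity)]; linarith))).2
    have h2 := (abs_le.1 (Real.abs_exp_sub_one_sub_id_le (x := a / 4 * (-(1 + a)))
      (by rw [abs_of_nonpos (by nlinarith)]; nlinarith))).2
    nlinarith [mul_nonneg (pow_pos ha 2).le (by nlinarith : 0 ≤ 3 - (1 + a) ^ 2)]
  have h0 : Real.exp (a / 4 * -a) ≤ 1 := by
    rw [Real.exp_le_one_iff]; nlinarith
  rcases hu with rfl | rfl <;> rcases hv with rfl | rfl
  · norm_num
  · simp only [mul_one, zero_sub, mul_zero, sub_zero]; linarith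
  · simp only [mul_one, zero_sub, mul_zero, sub_zero]; linarith
  · have : (1 : ℝ) - (1 + a) * 1 = -a := by ring
    rw [this]; linarith

open Classical in
-- Chernoff's method for uniformly random swaps, in counting form: the exponential sum factors over
-- the pairs, and each factor is at most `2`.
theorem card_swaps_le {n : ℕ} {a c : ℝ} (ha : 0 < a) (ha1 : a ≤ 2 / 5) (u v : Fin n → ℝ)
    (hu : ∀ j, u j = 0 ∨ u j = 1) (hv : ∀ j, v j = 0 ∨ v j = 1) :
    ((Finset.univ.filter fun σ : Fin n → Bool =>
      (1 + a) * ∑ j, (if σ j then v j else u j) + c ≤ ∑ j, (if σ j then u j else v j)).card : ℝ)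
      ≤ 2 ^ n * Real.exp (-(a / 4 * c)) := by
  have hsum : ∑ σ : Fin n → Bool, Real.exp (a / 4 *
      (∑ j, (if σ j then u j else v j) - (1 + a) * ∑ j, (if σ j then v j else u j))) ≤ 2 ^ n := by
    have h1 : ∀ σ : Fin n → Bool, Real.exp (a / 4 *
        (∑ j, (if σ j then u j else v j) - (1 + a) * ∑ j, (if σ j then v j else u j))) =
        ∏ j, (fun j (b : Bool) => Real.exp (a / 4 * ((if b then u j else v j) -
          (1 + a) * (if b then v j else u j)))) j (σ j) := by
      intro σ
      rw [← Real.exp_sum, Finset.mul_sum, ← Finset.sum_sub_distrib, Finset.mul_sum]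
    rw [Finset.sum_congr rfl fun σ _ => h1 σ]
    rw [← Fintype.prod_sum fun j (b : Bool) => Real.exp (a / 4 * ((if b then u j else v j) -
      (1 + a) * (if b then v j else u j)))]
    calc _ ≤ ∏ _j : Fin n, (2 : ℝ) := by
          refine Finset.prod_le_prod (fun j _ => by positivity) fun j _ => ?_
          simpa using swap_factor_le ha ha1 (hu j) (hv j)
      _ = 2 ^ n := by simp
  rw [Real.exp_neg, ← div_eq_mul_inv, le_div_iff₀ (Real.exp_pos _)]
  refine le_trans ?_ hsum
  rw [← nsmul_eq_mul]
  refine le_trans (Finset.card_nsmul_le_sum _ (fun σ : Fin n → Bool => Real.exp (a / 4 *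
      (∑ j, (if σ j then u j else v j) - (1 + a) * ∑ j, (if σ j then v j else u j)))) _ ?_) ?_
  · intro σ hσ
    have := (Finset.mem_filter.1 hσ).2
    apply Real.exp_le_exp.2
    apply mul_le_mul_of_nonneg_left _ (by positivity)
    linarith
  · exact Finset.sum_le_sum_of_subset_of_nonneg (Finset.filter_subset _ _)
      fun _ _ _ => (Real.exp_pos _).le

/-! ### Empirical errors -/

/-- The indicator of a mislabelled example. -/
noncomputable def mislabel {X : Type*} (f : X → Bool) (z : X × Bool) : ℝ :=
  if f z.1 ≠ z.2 then 1 else 0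

theorem mislabel_eq {X : Type*} (f : X → Bool) (z : X × Bool) :
    mislabel f z = 0 ∨ mislabel f z = 1 := by
  unfold mislabel; split_ifs <;> simp

theorem mislabel_nonneg {X : Type*} (f : X → Bool) (z : X × Bool) : 0 ≤ mislabel f z := by
  unfold mislabel; split_ifs <;> simp

theorem mislabel_le_one {X : Type*} (f : X → Bool) (z : X × Bool) : mislabel f z ≤ 1 := by
  unfold mislabel; split_ifs <;> simp

theorem empErr_eq {X : Type*} {n : ℕ} (S : Sample X n) (f : X → Bool) :
    empErr S f = (∑ j, mislabel f (S j)) / n := by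
  unfold empErr mislabel
  rw [Finset.sum_boole]

theorem empErr_nonneg {X : Type*} {n : ℕ} (S : Sample X n) (f : X → Bool) : 0 ≤ empErr S f := by
  unfold empErr; positivity

theorem empErr_le_one {X : Type*} {n : ℕ} (S : Sample X n) (f : X → Bool) : empErr S f ≤ 1 := by
  unfold empErr
  apply div_le_one_of_le₀ _ (by positivity)
  exact_mod_cast (Finset.card_filter_le _ _).trans (by simp)

section

variable {X : Type*} [MeasurableSpace X]

theorem measurableSet_mislabelled {f : X → Bool} (hf : Measurable f) :
    MeasurableSet {z : X × Bool | f z.1 ≠ z.2} :=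
  (measurableSet_eq_fun (hf.comp measurable_fst) measurable_snd).compl

theorem measurable_mislabel {f : X → Bool} (hf : Measurable f) : Measurable (mislabel f) :=
  Measurable.ite (measurableSet_mislabelled hf) measurable_const measurable_const

theorem measurable_empErr {n : ℕ} {f : X → Bool} (hf : Measurable f) :
    Measurable fun S : Sample X n => empErr S f := by
  simp only [empErr_eq]
  exact (Finset.measurable_sum _ fun j _ =>
    (measurable_mislabel hf).comp (measurable_pi_apply j)).div_const _

theorem err_nonneg (P : Measure (X × Bool)) (f : X → Bool) : 0 ≤ err P f := measureReal_nonneg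

theorem integral_mislabel (P : Measure (X × Bool)) {f : X → Bool} (hf : Measurable f) :
    ∫ z, mislabel f z ∂P = err P f := by
  have : mislabel f = Set.indicator {z : X × Bool | f z.1 ≠ z.2} 1 := by
    funext z; simp [mislabel, Set.indicator]
  rw [this, integral_indicator_one (measurableSet_mislabelled hf), err]

theorem integrable_mislabel (P : Measure (X × Bool)) [IsFiniteMeasure P] {f : X → Bool}
    (hf : Measurable f) : Integrable (mislabel f) P :=
  Integrable.of_bound (measurable_mislabel hf).aestronglyMeasurable 1 (Filter.Eventually.of_forall
    fun z => by rw [Real.norm_of_nonneg (mislabel_nonneg f z)]; exact mislabel_le_one f z)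

theorem integral_empErr {n : ℕ} (hn : 0 < n) (P : Measure (X × Bool)) [IsProbabilityMeasure P]
    {f : X → Bool} (hf : Measurable f) :
    ∫ S : Sample X n, empErr S f ∂(Measure.pi fun _ => P) = err P f := by
  simp only [empErr_eq]
  rw [integral_div, integral_finsetSum]
  · have : ∀ j : Fin n, ∫ S : Sample X n, mislabel f (S j) ∂(Measure.pi fun _ => P) = err P f := by
      intro j
      rw [integral_comp_eval (μ := fun _ : Fin n => P) (i := j) (f := mislabel f)
        (measurable_mislabel hf).aestronglyMeasurable, integral_mislabel P hf]
    simp only [this, Finset.sum_const, Finset.card_univ, Fintype.card_fin, nsmul_eq_mul]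
    field_simp
  · intro j _
    exact integrable_comp_eval (μ := fun _ : Fin n => P) (i := j) (integrable_mislabel P hf)

/-- On the values `0` and `1` the exponential is affine, and `exp l - 1 ≤ l + l²` for `|l| ≤ 1`,
with either sign of `l`. -/
theorem integral_exp_mislabel_le {P : Measure (X × Bool)} [IsProbabilityMeasure P]
    {f : X → Bool} (hf : Measurable f) {l : ℝ} (hl : |l| ≤ 1) :
    ∫ z, Real.exp (l * mislabel f z) ∂P ≤ Real.exp (err P f * (l + l ^ 2)) := by
  have h : ∀ z, Real.exp (l * mislabel f z) = 1 + (Real.exp l - 1) * mislabel f z := by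
    intro z
    rcases mislabel_eq f z with h | h <;> simp [h]
  simp only [h]
  rw [integral_add (integrable_const _) ((integrable_mislabel P hf).const_mul _),
    integral_const_mul, integral_mislabel P hf]
  have h1 := (abs_le.1 (Real.abs_exp_sub_one_sub_id_le hl)).2
  have h2 := Real.add_one_le_exp (err P f * (l + l ^ 2))
  have h3 := err_nonneg P f
  simp only [integral_const, probReal_univ, smul_eq_mul, mul_one]
  nlinarith

/-- Chernoff's bound, for the upper tail (`0 < l`) and the lower tail (`l < 0`). -/
theorem chernoff_empErr {n : ℕ} (P : Measure (X × Bool)) [IsProbabilityMeasure P]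
    {f : X → Bool} (hf : Measurable f) {l c : ℝ} (hl : |l| ≤ 1) (hn : 0 < n) :
    (Measure.pi fun _ : Fin n => P).real
      {S | l ^ 2 * err P f + c ≤ l * (empErr S f - err P f)} ≤ Real.exp (-(c * n)) := by
  set μ := Measure.pi fun _ : Fin n => P
  have hm : ∀ S : Sample X n, Real.exp (∑ j, l * mislabel f (S j)) =
      ∏ j, Real.exp (l * mislabel f (S j)) := fun S => Real.exp_sum _ _
  have hint : ∫ S : Sample X n, Real.exp (∑ j, l * mislabel f (S j)) ∂μ ≤
      Real.exp (n * (err P f * (l + l ^ 2))) := by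
    simp only [hm]
    rw [integral_fintype_prod_eq_pow (fun z => Real.exp (l * mislabel f z)), Fintype.card_fin,
      Real.exp_nat_mul]
    exact pow_le_pow_left₀ (integral_nonneg fun _ => (Real.exp_pos _).le)
      (integral_exp_mislabel_le hf hl) n
  have hmeas : Measurable fun S : Sample X n => Real.exp (∑ j, l * mislabel f (S j)) :=
    Real.measurable_exp.comp (Finset.measurable_sum _ fun j _ =>
      ((measurable_mislabel hf).comp (measurable_pi_apply j)).const_mul l)
  have hb : Integrable (fun S : Sample X n => Real.exp (∑ j, l * mislabel f (S j))) μ := by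
    refine Integrable.of_bound hmeas.aestronglyMeasurable (Real.exp n)
      (Filter.Eventually.of_forall fun S => ?_)
    rw [Real.norm_of_nonneg (Real.exp_pos _).le]
    apply Real.exp_le_exp.2
    calc ∑ j, l * mislabel f (S j) ≤ ∑ _j : Fin n, (1 : ℝ) := by
          refine Finset.sum_le_sum fun j _ => ?_
          have := (abs_le.1 hl).2
          have := mislabel_nonneg f (S j)
          have := mislabel_le_one f (S j)
          nlinarith
      _ = n := by simp
  have hmark := mul_meas_ge_le_integral_of_nonneg (μ := μ)
    (Filter.Eventually.of_forall fun S : Sample X n => (Real.exp_pos (∑ j, l * mislabel f (S j))).le)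
    hb (Real.exp (n * (err P f * (l + l ^ 2)) + c * n))
  have hsub : {S : Sample X n | l ^ 2 * err P f + c ≤ l * (empErr S f - err P f)} ⊆
      {S | Real.exp (n * (err P f * (l + l ^ 2)) + c * n) ≤
        Real.exp (∑ j, l * mislabel f (S j))} := by
    intro S hS
    simp only [Set.mem_ofPred_eq] at hS ⊢
    apply Real.exp_le_exp.2
    rw [← Finset.mul_sum]
    have hn' : (0 : ℝ) < n := by exact_mod_cast hn
    have : ∑ j, mislabel f (S j) = n * empErr S f := by
      rw [empErr_eq]; field_simp
    rw [this]
    nlinarith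
  have h1 : μ.real {S | l ^ 2 * err P f + c ≤ l * (empErr S f - err P f)} ≤
      μ.real {S | Real.exp (n * (err P f * (l + l ^ 2)) + c * n) ≤
        Real.exp (∑ j, l * mislabel f (S j))} := measureReal_mono hsub
  have h2 := (mul_le_mul_of_nonneg_left h1 (Real.exp_pos
    (n * (err P f * (l + l ^ 2)) + c * n)).le).trans (hmark.trans hint)
  rw [Real.exp_add, mul_assoc] at h2
  have h3 := le_of_mul_le_mul_left (h2.trans_eq (mul_one _).symm) (Real.exp_pos _)
  rw [Real.exp_neg, ← one_div, le_div_iff₀ (Real.exp_pos _), mul_comm]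
  exact h3

end

section

variable {X : Type*} [MeasurableSpace X]

/-! ### Measurability of errors of a measurable family of classifiers -/

theorem measurableSet_mislabelled_family {Y : Type*} [MeasurableSpace Y] {G : Y → X → Bool}
    (hG : Measurable fun p : Y × X => G p.1 p.2) :
    MeasurableSet {p : Y × (X × Bool) | G p.1 p.2.1 ≠ p.2.2} :=
  (measurableSet_eq_fun (hG.comp (measurable_fst.prodMk (measurable_fst.comp measurable_snd)))
    (measurable_snd.comp measurable_snd)).compl

theorem measurable_err_family {Y : Type*} [MeasurableSpace Y] {G : Y → X → Bool}
    (hG : Measurable fun p : Y × X => G p.1 p.2) (P : Measure (X × Bool)) [IsProbabilityMeasure P] :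
    Measurable fun y => err P (G y) :=
  (measurable_measure_prodMk_left (measurableSet_mislabelled_family hG)).ennreal_toReal

theorem measurable_empErr_family {Y : Type*} [MeasurableSpace Y] {G : Y → X → Bool} {m : ℕ}
    {T : Y → Sample X m} (hG : Measurable fun p : Y × X => G p.1 p.2) (hT : Measurable T) :
    Measurable fun y => empErr (T y) (G y) := by
  simp only [empErr_eq]
  refine (Finset.measurable_sum _ fun j _ => ?_).div_const _
  refine Measurable.ite ?_ measurable_const measurable_const
  have h : Measurable fun y => (y, T y j) := measurable_id.prodMk ((measurable_pi_apply j).comp hT)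
  exact h (measurableSet_mislabelled_family hG)

theorem measurable_family_apply {Y : Type*} [MeasurableSpace Y] {G : Y → X → Bool}
    (hG : Measurable fun p : Y × X => G p.1 p.2) (y : Y) : Measurable (G y) :=
  hG.comp (measurable_const.prodMk measurable_id)

/-! ### Symmetrization -/

/-- Exchange the two halves of a double sample at the places marked by `σ`. -/
def swapPairs {Z : Type*} {n : ℕ} (σ : Fin n → Bool) (ω : Fin n → Z × Z) : Fin n → Z × Z :=
  fun j => if σ j then (ω j).swap else ω j

theorem measurePreserving_swapPairs {Z : Type*} [MeasurableSpace Z] {n : ℕ} (σ : Fin n → Bool)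
    (P : Measure Z) [IsProbabilityMeasure P] :
    MeasurePreserving (swapPairs (Z := Z) σ) (Measure.pi fun _ : Fin n => P.prod P)
      (Measure.pi fun _ : Fin n => P.prod P) := by
  refine measurePreserving_pi (fun _ : Fin n => P.prod P) (fun _ : Fin n => P.prod P)
    (f := fun j z => if σ j then z.swap else z) fun j => ?_
  by_cases h : σ j
  · simpa [h] using Measure.measurePreserving_swap (μ := P) (ν := P)
  · simp only [h]
    exact MeasurePreserving.id (P.prod P)

/-- The double samples on which the classifier chosen from the first half does markedly worse on
the second half. -/
def gapSet {n : ℕ} (G : Sample X n → X → Bool) (a e : ℝ) : Set (Sample X n × Sample X n) :=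
  {p | (1 + a) * empErr p.1 (G p.1) + e ≤ empErr p.2 (G p.1)}

theorem measurableSet_gapSet {n : ℕ} {G : Sample X n → X → Bool}
    (hG : Measurable fun p : Sample X n × X => G p.1 p.2) (a e : ℝ) :
    MeasurableSet (gapSet G a e) := by
  have hG' : Measurable fun p : (Sample X n × Sample X n) × X => G p.1.1 p.2 :=
    hG.comp ((measurable_fst.comp measurable_fst).prodMk measurable_snd)
  refine measurableSet_le (((measurable_empErr_family hG' measurable_fst).const_mul _).add_const _)
    (measurable_empErr_family hG' measurable_snd)

-- The chosen classifier changes with the swap, since it depends on the swapped first half, but its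
-- trace on the `2 n` points always lies in one set that does not depend on the swap. A union bound
-- over this set reduces to a fixed labelling.
open Classical in
theorem card_swaps_mem_gapSet_le {X : Type*} {n d : ℕ} {F : Set (X → Bool)} (hd : vcDim F ≤ d) (hn : 0 < n)
    {G : Sample X n → X → Bool} (hF : ∀ S, G S ∈ F) {a e : ℝ} (ha : 0 < a) (ha1 : a ≤ 2 / 5)
    (ω : Fin n → (X × Bool) × (X × Bool)) :
    ((Finset.univ.filter fun σ : Fin n → Bool =>
      ((fun j => (swapPairs σ ω j).1, fun j => (swapPairs σ ω j).2) :
        Sample X n × Sample X n) ∈ gapSet G a e).card : ℝ) ≤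
      (∑ i ∈ Finset.Iic d, ((2 * n).choose i : ℝ)) *
        (2 ^ n * Real.exp (-(a / 4 * (e * n)))) := by
  obtain ⟨R, hR, hcard⟩ := exists_traces_card_le hd
    (fun i : Fin n ⊕ Fin n => Sum.elim (fun j => (ω j).1.1) (fun j => (ω j).2.1) i)
  have hcard' : (R.card : ℝ) ≤ ∑ i ∈ Finset.Iic d, ((2 * n).choose i : ℝ) := by
    have : Fintype.card (Fin n ⊕ Fin n) = 2 * n := by simp; ring
    rw [this] at hcard
    exact_mod_cast hcard
  let u : (Fin n ⊕ Fin n → Bool) → Fin n → ℝ := fun g j =>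
    if g (Sum.inl j) ≠ (ω j).1.2 then 1 else 0
  let v : (Fin n ⊕ Fin n → Bool) → Fin n → ℝ := fun g j =>
    if g (Sum.inr j) ≠ (ω j).2.2 then 1 else 0
  have hn' : (0 : ℝ) < n := by exact_mod_cast hn
  have hsub : (Finset.univ.filter fun σ : Fin n → Bool =>
      ((fun j => (swapPairs σ ω j).1, fun j => (swapPairs σ ω j).2) :
        Sample X n × Sample X n) ∈ gapSet G a e) ⊆
      R.biUnion fun g => Finset.univ.filter fun σ : Fin n → Bool =>
        (1 + a) * ∑ j, (if σ j then v g j else u g j) + e * n ≤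
          ∑ j, (if σ j then u g j else v g j) := by
    intro σ hσ
    have h := (Finset.mem_filter.1 hσ).2
    set f := G fun j => (swapPairs σ ω j).1
    refine Finset.mem_biUnion.2 ⟨_, hR f (hF _), Finset.mem_filter.2 ⟨Finset.mem_univ _, ?_⟩⟩
    simp only [gapSet, Set.mem_ofPred_eq, empErr_eq] at h
    rw [mul_div_assoc', div_add' _ _ _ hn'.ne', div_le_div_iff_of_pos_right hn'] at h
    have e1 : ∀ j, mislabel f (swapPairs σ ω j).1 =
        if σ j then v (fun i => f (Sum.elim (fun j => (ω j).1.1) (fun j => (ω j).2.1) i)) j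
        else u (fun i => f (Sum.elim (fun j => (ω j).1.1) (fun j => (ω j).2.1) i)) j := by
      intro j
      by_cases hj : σ j <;> simp [swapPairs, hj, u, v, mislabel] <;> congr
    have e2 : ∀ j, mislabel f (swapPairs σ ω j).2 =
        if σ j then u (fun i => f (Sum.elim (fun j => (ω j).1.1) (fun j => (ω j).2.1) i)) j
        else v (fun i => f (Sum.elim (fun j => (ω j).1.1) (fun j => (ω j).2.1) i)) j := by
      intro j
      by_cases hj : σ j <;> simp [swapPairs, hj, u, v, mislabel] <;> congr
    rw [← Finset.sum_congr rfl fun j _ => e1 j, ← Finset.sum_congr rfl fun j _ => e2 j]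
    exact h
  have h1 := (Finset.card_le_card hsub).trans Finset.card_biUnion_le
  calc _ ≤ ((∑ g ∈ R, (Finset.univ.filter fun σ : Fin n → Bool =>
        (1 + a) * ∑ j, (if σ j then v g j else u g j) + e * n ≤
          ∑ j, (if σ j then u g j else v g j)).card : ℕ) : ℝ) := by exact_mod_cast h1
    _ ≤ ∑ g ∈ R, 2 ^ n * Real.exp (-(a / 4 * (e * n))) := by
        push_cast
        refine Finset.sum_le_sum fun g _ => card_swaps_le ha ha1 _ _ (fun j => ?_) (fun j => ?_)
        · simp only [u]; split_ifs <;> simp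
        · simp only [v]; split_ifs <;> simp
    _ ≤ _ := by
        rw [Finset.sum_const, nsmul_eq_mul]
        gcongr

/-- The law of the double sample is invariant under every swap, so the probability is the mean over
all swaps, and the count of bad swaps bounds that mean pointwise. Working with a measurable choice
`G` instead of a supremum over `F` keeps the event measurable. -/
theorem measureReal_gapSet_le {n d : ℕ} {F : Set (X → Bool)} (hd : vcDim F ≤ d) (hn : 0 < n)
    {G : Sample X n → X → Bool} (hF : ∀ S, G S ∈ F)
    (hG : Measurable fun p : Sample X n × X => G p.1 p.2) {a e : ℝ} (ha : 0 < a)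
    (ha1 : a ≤ 2 / 5) (P : Measure (X × Bool)) [IsProbabilityMeasure P] :
    ((Measure.pi fun _ : Fin n => P).prod (Measure.pi fun _ : Fin n => P)).real (gapSet G a e) ≤
      (∑ i ∈ Finset.Iic d, ((2 * n).choose i : ℝ)) * Real.exp (-(a / 4 * (e * n))) := by
  classical
  set ν := Measure.pi fun _ : Fin n => P.prod P
  have hE := measurableSet_gapSet hG a e
  have hmp := measurePreserving_arrowProdEquivProdArrow (X × Bool) (X × Bool) (Fin n)
    (fun _ => P) (fun _ => P)
  have hmpσ : ∀ σ : Fin n → Bool, MeasurePreserving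
      (fun ω : Fin n → (X × Bool) × (X × Bool) => ((fun j => (swapPairs σ ω j).1,
        fun j => (swapPairs σ ω j).2) : Sample X n × Sample X n)) ν
      ((Measure.pi fun _ : Fin n => P).prod (Measure.pi fun _ : Fin n => P)) := fun σ =>
    hmp.comp (measurePreserving_swapPairs σ P)
  set p := ((Measure.pi fun _ : Fin n => P).prod (Measure.pi fun _ : Fin n => P)).real
    (gapSet G a e)
  let A : (Fin n → Bool) → Set (Fin n → (X × Bool) × (X × Bool)) := fun σ =>
    {ω | ((fun j => (swapPairs σ ω j).1, fun j => (swapPairs σ ω j).2) :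
      Sample X n × Sample X n) ∈ gapSet G a e}
  have hA : ∀ σ, MeasurableSet (A σ) := fun σ => (hmpσ σ).measurable hE
  have hp : ∀ σ, ∫ ω, (A σ).indicator (1 : (Fin n → (X × Bool) × (X × Bool)) → ℝ) ω ∂ν = p := by
    intro σ
    rw [integral_indicator_one (hA σ)]
    exact congrArg ENNReal.toReal ((hmpσ σ).measure_preimage hE.nullMeasurableSet)
  have hint : ∀ σ ∈ Finset.univ, Integrable ((A σ).indicator (1 : (Fin n → (X × Bool) × (X × Bool)) → ℝ)) ν := fun σ _ =>
    (integrable_const (1 : ℝ)).indicator (hA σ)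
  have hsum : (2 : ℝ) ^ n * p = ∫ ω, ∑ σ, (A σ).indicator (1 : (Fin n → (X × Bool) × (X × Bool)) → ℝ) ω ∂ν := by
    rw [integral_finsetSum _ hint]
    simp [hp]
  have hle : (2 : ℝ) ^ n * p ≤ (∑ i ∈ Finset.Iic d, ((2 * n).choose i : ℝ)) *
      (2 ^ n * Real.exp (-(a / 4 * (e * n)))) := by
    rw [hsum]
    calc _ ≤ ∫ _ω, (∑ i ∈ Finset.Iic d, ((2 * n).choose i : ℝ)) *
          (2 ^ n * Real.exp (-(a / 4 * (e * n)))) ∂ν := by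
          refine integral_mono (integrable_finsetSum _ hint) (integrable_const _) fun ω => ?_
          refine le_trans (le_of_eq ?_) (card_swaps_mem_gapSet_le hd hn hF ha ha1 ω)
          simp only [Set.indicator_apply, Pi.one_apply, Finset.sum_boole, A, Set.mem_ofPred_eq]
      _ = _ := by simp
  rw [mul_left_comm] at hle
  exact le_of_mul_le_mul_left hle (by positivity)

/-- Ghost sample: given a bad first sample, the chosen classifier is fixed, and an independent
second sample shows an error close to the true one with probability at least `1 / 2`. -/
theorem measureReal_le_two_mul_gapSet {n : ℕ} {G : Sample X n → X → Bool}
    (hG : Measurable fun p : Sample X n × X => G p.1 p.2) {a e : ℝ} (ha : 0 < a)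
    (ha1 : a ≤ 1 / 3) (he : 0 < e) (hn : 0 < n) (hne : 1 ≤ a * e * n)
    (P : Measure (X × Bool)) [IsProbabilityMeasure P] :
    (Measure.pi fun _ : Fin n => P).real
        {S | (1 + 3 * a) * empErr S (G S) + 3 * e < err P (G S)} ≤
      2 * ((Measure.pi fun _ : Fin n => P).prod (Measure.pi fun _ : Fin n => P)).real
        (gapSet G a e) := by
  set μ := Measure.pi fun _ : Fin n => P
  set B := {S : Sample X n | (1 + 3 * a) * empErr S (G S) + 3 * e < err P (G S)}
  have hB : MeasurableSet B := measurableSet_lt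
    (((measurable_empErr_family hG measurable_id).const_mul _).add_const _)
    (measurable_err_family hG P)
  have hhalf : ∀ S ∈ B, (2 : ENNReal)⁻¹ ≤ μ (Prod.mk S ⁻¹' gapSet G a e) := by
    intro S hS
    have hm : MeasurableSet (Prod.mk S ⁻¹' gapSet G a e) :=
      measurable_prodMk_left (measurableSet_gapSet hG a e)
    -- Lower tail: outside the gap set the second sample underestimates the error by at least `a *
    -- err + e`. The factors `3` in the definition of a bad sample leave room for this when `a ≤ 1 /
    -- 3`.
    have hc := chernoff_empErr P (measurable_family_apply hG S) (l := -a) (c := a * e)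
      (by rw [abs_neg, abs_of_pos ha]; linarith) hn
    have hsub : (Prod.mk S ⁻¹' gapSet G a e)ᶜ ⊆
        {S' : Sample X n | (-a) ^ 2 * err P (G S) + a * e ≤
          -a * (empErr S' (G S) - err P (G S))} := by
      intro S' hS'
      simp only [gapSet, Set.mem_compl_iff, Set.mem_preimage, Set.mem_ofPred_eq, not_le] at hS' ⊢
      simp only [B, Set.mem_ofPred_eq] at hS
      have hq := empErr_nonneg S (G S)
      have : a * err P (G S) + e ≤ err P (G S) - empErr S' (G S) := by
        nlinarith [mul_nonneg (mul_nonneg ha.le (by linarith : 0 ≤ 1 - 3 * a)) hq,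
          mul_nonneg he.le (by linarith : 0 ≤ 1 - 3 * a),
          mul_nonneg (by linarith : 0 ≤ 1 - a) (sub_nonneg.2 hS.le)]
      nlinarith
    have h1 : μ.real (Prod.mk S ⁻¹' gapSet G a e)ᶜ ≤ 1 / 2 := by
      refine (measureReal_mono hsub).trans (hc.trans ?_)
      calc Real.exp (-(a * e * n)) ≤ Real.exp (-1) := Real.exp_le_exp.2 (by linarith)
        _ ≤ 1 / 2 := by
          rw [Real.exp_neg, ← one_div]
          exact one_div_le_one_div_of_le (by norm_num) (by linarith [Real.add_one_le_exp (1 : ℝ)])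
    rw [measureReal_compl hm, probReal_univ] at h1
    have h2 : (1 / 2 : ℝ) ≤ μ.real (Prod.mk S ⁻¹' gapSet G a e) := by linarith
    have h3 := ENNReal.ofReal_le_ofReal h2
    rw [measureReal_def, ENNReal.ofReal_toReal (measure_ne_top _ _)] at h3
    refine le_trans (le_of_eq ?_) h3
    rw [one_div, ENNReal.ofReal_inv_of_pos (by norm_num)]
    norm_num
  have hmain : (2 : ENNReal)⁻¹ * μ B ≤ (μ.prod μ) (gapSet G a e) := by
    rw [Measure.prod_apply (measurableSet_gapSet hG a e)]
    calc (2 : ENNReal)⁻¹ * μ B = ∫⁻ _S in B, (2 : ENNReal)⁻¹ ∂μ := by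
          rw [setLIntegral_const]
      _ ≤ ∫⁻ S in B, μ (Prod.mk S ⁻¹' gapSet G a e) ∂μ := setLIntegral_mono' hB hhalf
      _ ≤ _ := setLIntegral_le_lintegral _ _
  have h := ENNReal.toReal_mono (measure_ne_top _ _) hmain
  rw [ENNReal.toReal_mul, ENNReal.toReal_inv] at h
  simp only [measureReal_def]
  norm_num at h
  linarith

/-- Relative uniform convergence for a measurable choice from a class of bounded VC dimension. -/
theorem measureReal_err_gt_le {n d : ℕ} {F : Set (X → Bool)} (hd : vcDim F ≤ d)
    {G : Sample X n → X → Bool} (hF : ∀ S, G S ∈ F)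
    (hG : Measurable fun p : Sample X n × X => G p.1 p.2) {a e : ℝ} (ha : 0 < a)
    (ha1 : a ≤ 1 / 3) (he : 0 < e) (he1 : e ≤ 1) (hn : 0 < n) (hne : 1 ≤ a * e * n)
    (P : Measure (X × Bool)) [IsProbabilityMeasure P] :
    (Measure.pi fun _ : Fin n => P).real
        {S | (1 + 3 * a) * empErr S (G S) + 3 * e < err P (G S)} ≤
      2 * (16 / (a * e)) ^ d * Real.exp (-(a * e * n / 8)) := by
  have h1 := measureReal_le_two_mul_gapSet hG ha ha1 he hn hne P
  have h2 := measureReal_gapSet_le hd hn hF hG (e := e) ha (by linarith) P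
  -- With this `x` the growth function costs `exp (a e n / 8)`, half of the available exponent `a e
  -- n / 4`.
  have h3 := sum_choose_le_exp d (2 * n) (x := a * e / 16) (by positivity) (by nlinarith)
  rw [one_div_div] at h3
  have h4 := mul_le_mul_of_nonneg_right h3 (Real.exp_pos (-(a / 4 * (e * n)))).le
  rw [mul_assoc, ← Real.exp_add] at h4
  have h5 : a * e / 16 * ((2 * n : ℕ) : ℝ) + -(a / 4 * (e * n)) = -(a * e * n / 8) := by
    push_cast; ring
  rw [h5] at h4
  linarith

end

section

variable {X : Type*} {k nS nT : ℕ} {O : ∀ n : ℕ, Sample X n → X → Bool} {a e : ℝ}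

/-! ### Weights -/

/-- The denominator of the increments. -/
noncomputable def slack (O : ∀ n : ℕ, Sample X n → X → Bool) (a e : ℝ) (S : Sample X nS) : ℝ :=
  (1 + 3 * a) * empErr S (O nS S) + 3 * e

theorem slack_ge (ha : 0 < a) (S : Sample X nS) : 3 * e ≤ slack O a e S := by
  have := empErr_nonneg S (O nS S)
  unfold slack
  nlinarith [mul_nonneg ha.le this]

theorem slack_pos (ha : 0 < a) (he : 0 < e) (S : Sample X nS) : 0 < slack O a e S := by
  linarith [slack_ge (O := O) (e := e) ha S]

theorem increment_eq (ρ : RoundData X k nS nT) (i : Fin k) :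
    increment O a e ρ i = empErr (ρ.2 i) (O nS ρ.1) * (e * a / slack O a e ρ.1) := by
  unfold increment roundClassifier slack
  ring

theorem increment_nonneg (ha : 0 < a) (he : 0 < e) (ρ : RoundData X k nS nT) (i : Fin k) :
    0 ≤ increment O a e ρ i := by
  rw [increment_eq]
  have := slack_pos (O := O) ha he ρ.1
  have := empErr_nonneg (ρ.2 i) (O nS ρ.1)
  positivity

theorem ratio_le (ha : 0 < a) (he : 0 < e) (S : Sample X nS) :
    e * a / slack O a e S ≤ a / 3 := by
  have h := slack_ge (O := O) (e := e) ha S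
  rw [div_le_div_iff₀ (slack_pos ha he S) (by norm_num)]
  nlinarith

/-- The term `3 e` in the denominator caps the increments. This cap is what permits the linear bound
on `(1 + s)⁻¹` for the weight of a single player. -/
theorem increment_le (ha : 0 < a) (he : 0 < e) (ρ : RoundData X k nS nT) (i : Fin k) :
    increment O a e ρ i ≤ a / 3 := by
  rw [increment_eq]
  have h1 := ratio_le (O := O) ha he ρ.1
  have h2 : 0 ≤ e * a / slack O a e ρ.1 := by
    have := slack_pos (O := O) ha he ρ.1
    positivity
  have h3 := empErr_le_one (ρ.2 i) (O nS ρ.1)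
  nlinarith

theorem weight_snoc (r : ℕ) (h : Fin r → RoundData X k nS nT) (ρ : RoundData X k nS nT)
    (i : Fin k) :
    weight O a e (r + 1) (Fin.snoc (α := fun _ => RoundData X k nS nT) h ρ) i =
      weight O a e r h i * (1 + increment O a e ρ i) := by
  simp [weight]

theorem weight_eq_prod (r : ℕ) (h : Fin r → RoundData X k nS nT) (i : Fin k) :
    weight O a e r h i = ∏ j, (1 + increment O a e (h j) i) := by
  induction r with
  | zero => simp [weight]
  | succ r ih =>
    rw [weight, ih, Fin.prod_univ_castSucc]
    rfl

theorem weight_pos (ha : 0 < a) (he : 0 < e) (r : ℕ) (h : Fin r → RoundData X k nS nT)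
    (i : Fin k) : 0 < weight O a e r h i := by
  rw [weight_eq_prod]
  exact Finset.prod_pos fun j _ => by linarith [increment_nonneg (O := O) ha he (h j) i]

theorem sum_weight_pos (ha : 0 < a) (he : 0 < e) (hk : 1 ≤ k) (r : ℕ)
    (h : Fin r → RoundData X k nS nT) : 0 < ∑ i, weight O a e r h i := by
  have : Nonempty (Fin k) := ⟨⟨0, hk⟩⟩
  exact Finset.sum_pos (fun i _ => weight_pos ha he r h i) Finset.univ_nonempty

variable [MeasurableSpace X]

theorem measurable_slack (hO : ∀ n : ℕ, Measurable fun p : Sample X n × X => O n p.1 p.2) :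
    Measurable fun S : Sample X nS => slack O a e S :=
  ((measurable_empErr_family (hO nS) measurable_id).const_mul _).add_const _

theorem measurable_increment (hO : ∀ n : ℕ, Measurable fun p : Sample X n × X => O n p.1 p.2)
    (i : Fin k) : Measurable fun ρ : RoundData X k nS nT => increment O a e ρ i := by
  simp only [increment_eq]
  have hG : Measurable fun p : RoundData X k nS nT × X => O nS p.1.1 p.2 :=
    (hO nS).comp ((measurable_fst.comp measurable_fst).prodMk measurable_snd)
  exact (measurable_empErr_family hG ((measurable_pi_apply i).comp measurable_snd)).mul
    (((measurable_slack hO).comp measurable_fst).const_div _)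

theorem measurable_weight (hO : ∀ n : ℕ, Measurable fun p : Sample X n × X => O n p.1 p.2)
    (r : ℕ) (i : Fin k) :
    Measurable fun h : Fin r → RoundData X k nS nT => weight O a e r h i := by
  simp only [weight_eq_prod]
  exact Finset.measurable_prod _ fun j _ =>
    ((measurable_increment hO i).comp (measurable_pi_apply j)).const_add 1

/-! ### The mixture and the law of a round -/

theorem isProbabilityMeasure_mixture (D : Fin k → Measure (X × Bool))
    [∀ i, IsProbabilityMeasure (D i)] {w : Fin k → ℝ} (hw : ∀ i, 0 ≤ w i) (hW : 0 < ∑ i, w i) :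
    IsProbabilityMeasure (mixture D w) := by
  constructor
  simp only [mixture, Measure.coe_finsetSum, Measure.coe_smul, Finset.sum_apply, Pi.smul_apply,
    measure_univ, smul_eq_mul, mul_one]
  rw [← ENNReal.ofReal_sum_of_nonneg fun i _ => div_nonneg (hw i) hW.le, ← Finset.sum_div,
    div_self hW.ne', ENNReal.ofReal_one]

theorem err_mixture (D : Fin k → Measure (X × Bool)) [∀ i, IsProbabilityMeasure (D i)]
    {w : Fin k → ℝ} (hw : ∀ i, 0 ≤ w i) (f : X → Bool) :
    err (mixture D w) f = (∑ i, w i * err (D i) f) / ∑ i, w i := by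
  have hW : 0 ≤ ∑ i, w i := Finset.sum_nonneg fun i _ => hw i
  simp only [err, mixture, measureReal_def, Measure.coe_finsetSum, Measure.coe_smul,
    Finset.sum_apply, Pi.smul_apply, smul_eq_mul]
  rw [ENNReal.toReal_sum fun i _ => ENNReal.mul_ne_top ENNReal.ofReal_ne_top (measure_ne_top _ _),
    Finset.sum_div]
  refine Finset.sum_congr rfl fun i _ => ?_
  rw [ENNReal.toReal_mul, ENNReal.toReal_ofReal (div_nonneg (hw i) hW)]
  ring

theorem isProbabilityMeasure_mixture_weight (D : Fin k → Measure (X × Bool))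
    [∀ i, IsProbabilityMeasure (D i)] (ha : 0 < a) (he : 0 < e) (hk : 1 ≤ k) (r : ℕ)
    (h : Fin r → RoundData X k nS nT) : IsProbabilityMeasure (mixture D (weight O a e r h)) :=
  isProbabilityMeasure_mixture D (fun i => (weight_pos ha he r h i).le)
    (sum_weight_pos ha he hk r h)

theorem isProbabilityMeasure_roundLaw (D : Fin k → Measure (X × Bool))
    [∀ i, IsProbabilityMeasure (D i)] (ha : 0 < a) (he : 0 < e) (hk : 1 ≤ k) (r : ℕ)
    (h : Fin r → RoundData X k nS nT) : IsProbabilityMeasure (roundLaw D O a e r h) := by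
  have := isProbabilityMeasure_mixture_weight (O := O) D ha he hk r h
  unfold roundLaw
  infer_instance

theorem measurable_mixture_weight (D : Fin k → Measure (X × Bool))
    (hO : ∀ n : ℕ, Measurable fun p : Sample X n × X => O n p.1 p.2) (r : ℕ) :
    Measurable fun h : Fin r → RoundData X k nS nT => mixture D (weight O a e r h) := by
  refine Measure.measurable_of_measurable_coe _ fun s _ => ?_
  simp only [mixture, Measure.coe_finsetSum, Measure.coe_smul, Finset.sum_apply, Pi.smul_apply,
    smul_eq_mul]
  exact Finset.measurable_sum _ fun i _ => ((measurable_weight hO r i).div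
    (Finset.measurable_sum _ fun j _ => measurable_weight hO r j)).ennreal_ofReal.mul_const _

/-- For probability measures it suffices to test on rectangles, where the product laws become finite
products of functions that are measurable in the weights. -/
theorem measurable_roundLaw (D : Fin k → Measure (X × Bool)) [∀ i, IsProbabilityMeasure (D i)]
    (hO : ∀ n : ℕ, Measurable fun p : Sample X n × X => O n p.1 p.2) (ha : 0 < a) (he : 0 < e)
    (hk : 1 ≤ k) (r : ℕ) :
    Measurable fun h : Fin r → RoundData X k nS nT => roundLaw D O a e r h := by
  have := isProbabilityMeasure_mixture_weight (nS := nS) (nT := nT) (O := O) D ha he hk r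
  have := isProbabilityMeasure_roundLaw (nS := nS) (nT := nT) (O := O) D ha he hk r
  have hpi : Measurable fun h : Fin r → RoundData X k nS nT =>
      Measure.pi fun _ : Fin nS => mixture D (weight O a e r h) := by
    refine Measurable.measure_of_isPiSystem_of_isProbabilityMeasure generateFrom_pi.symm
      isPiSystem_pi ?_
    rintro _ ⟨s, hs, rfl⟩
    simp only [Measure.pi_pi]
    exact Finset.measurable_prod _ fun j _ =>
      (Measure.measurable_coe (show MeasurableSet (s j) from hs j (Set.mem_univ j))).comp (measurable_mixture_weight D hO r)
  refine Measurable.measure_of_isPiSystem_of_isProbabilityMeasure generateFrom_prod.symm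
    isPiSystem_prod ?_
  rintro _ ⟨u, hu, v, hv, rfl⟩
  simp only [roundLaw, Measure.prod_prod]
  exact ((Measure.measurable_coe (show MeasurableSet u from hu)).comp hpi).mul_const _

theorem measurable_snoc {Z : Type*} [MeasurableSpace Z] (r : ℕ) :
    Measurable fun p : (Fin r → Z) × Z => Fin.snoc (α := fun _ => Z) p.1 p.2 := by
  refine measurable_pi_iff.2 fun j => ?_
  refine Fin.lastCases ?_ (fun j => ?_) j
  · simpa only [Fin.snoc_last] using measurable_snd
  · simp only [Fin.snoc_castSucc]
    exact (measurable_pi_apply j).comp measurable_fst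

theorem measurable_snoc_left {Z : Type*} [MeasurableSpace Z] {r : ℕ} (h : Fin r → Z) :
    Measurable fun ρ : Z => Fin.snoc (α := fun _ => Z) h ρ :=
  (measurable_snoc r).comp measurable_prodMk_left

theorem measurable_roundLaw_map_snoc (D : Fin k → Measure (X × Bool))
    [∀ i, IsProbabilityMeasure (D i)]
    (hO : ∀ n : ℕ, Measurable fun p : Sample X n × X => O n p.1 p.2) (ha : 0 < a) (he : 0 < e)
    (hk : 1 ≤ k) (r : ℕ) :
    Measurable fun h : Fin r → RoundData X k nS nT => (roundLaw D O a e r h).map fun ρ =>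
      Fin.snoc (α := fun _ => RoundData X k nS nT) h ρ := by
  let κ : Kernel (Fin r → RoundData X k nS nT) (RoundData X k nS nT) :=
    ⟨fun h => roundLaw D O a e r h, measurable_roundLaw D hO ha he hk r⟩
  have : IsMarkovKernel κ := ⟨fun h => isProbabilityMeasure_roundLaw D ha he hk r h⟩
  refine Measure.measurable_of_measurable_coe _ fun s hs => ?_
  have h1 := Kernel.measurable_kernel_prodMk_left (κ := κ) (measurable_snoc r hs)
  convert h1 using 2 with h
  rw [Measure.map_apply (measurable_snoc_left h) hs]
  rfl

/-! ### Integration against the law of a run -/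

/-- Only upper bounds are needed, and in this direction the change of variables requires no
measurability of `φ` or of the kernels. -/
theorem lintegral_runLaw_succ_le (D : Fin k → Measure (X × Bool)) (r : ℕ)
    (φ : (Fin (r + 1) → RoundData X k nS nT) → ENNReal) :
    ∫⁻ h, φ h ∂(runLaw D O a e (r + 1)) ≤
      ∫⁻ h, ∫⁻ ρ, φ (Fin.snoc (α := fun _ => RoundData X k nS nT) h ρ) ∂(roundLaw D O a e r h)
        ∂(runLaw D O a e r) :=
  (Measure.lintegral_bind_le _ _ _).trans (lintegral_mono fun _ => lintegral_map_le _ _)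

theorem isProbabilityMeasure_runLaw (D : Fin k → Measure (X × Bool))
    [∀ i, IsProbabilityMeasure (D i)]
    (hO : ∀ n : ℕ, Measurable fun p : Sample X n × X => O n p.1 p.2) (ha : 0 < a) (he : 0 < e)
    (hk : 1 ≤ k) (r : ℕ) :
    IsProbabilityMeasure
      (runLaw D O a e r : Measure (Fin r → RoundData X k nS nT)) := by
  induction r with
  | zero => exact Measure.dirac.isProbabilityMeasure
  | succ r ih =>
    constructor
    rw [runLaw, Measure.bind_apply MeasurableSet.univ
      (measurable_roundLaw_map_snoc D hO ha he hk r).aemeasurable]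
    have : ∀ h : Fin r → RoundData X k nS nT, ((roundLaw D O a e r h).map fun ρ =>
        Fin.snoc (α := fun _ => RoundData X k nS nT) h ρ) Set.univ = 1 := by
      intro h
      have := isProbabilityMeasure_roundLaw (O := O) D ha he hk r h
      rw [Measure.map_apply (measurable_snoc_left h) MeasurableSet.univ]
      simp
    simp [this]

/-- The supermartingale principle behind both potentials: a conditional one-step bound iterates over
the rounds. -/
theorem lintegral_runLaw_le (D : Fin k → Measure (X × Bool))
    (φ : (r : ℕ) → (Fin r → RoundData X k nS nT) → ENNReal) (β : ENNReal)
    (hφ : ∀ r h, ∫⁻ ρ, φ (r + 1) (Fin.snoc (α := fun _ => RoundData X k nS nT) h ρ)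
      ∂(roundLaw D O a e r h) ≤ β * φ r h) (hβ : β ≠ ⊤) (r : ℕ) :
    ∫⁻ h, φ r h ∂(runLaw D O a e r) ≤ β ^ r * φ 0 Fin.elim0 := by
  induction r with
  | zero =>
    rw [runLaw, pow_zero, one_mul]
    have : ∀ h, φ 0 h = φ 0 Fin.elim0 := fun h => by rw [Subsingleton.elim h Fin.elim0]
    simp [this]
  | succ r ih =>
    calc _ ≤ _ := lintegral_runLaw_succ_le D r _
      _ ≤ ∫⁻ h, β * φ r h ∂(runLaw D O a e r) := lintegral_mono fun h => hφ r h
      _ = β * ∫⁻ h, φ r h ∂(runLaw D O a e r) := lintegral_const_mul' _ _ hβ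
      _ ≤ _ := by rw [pow_succ', mul_assoc]; gcongr

end

section

variable {X : Type*} {k nS nT : ℕ} {O : ∀ n : ℕ, Sample X n → X → Bool} {a e θ : ℝ}
  [MeasurableSpace X] {D : Fin k → Measure (X × Bool)}

/-! ### Accurate rounds -/

/-- The empirical error of the classifier of the round controls its error on the mixture, and is
itself at most `θ`. -/
def AccurateRound (D : Fin k → Measure (X × Bool)) (O : ∀ n : ℕ, Sample X n → X → Bool)
    (a e θ : ℝ) (w : Fin k → ℝ) (S : Sample X nS) : Prop :=
  err (mixture D w) (O nS S) ≤ slack O a e S ∧ empErr S (O nS S) ≤ θ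

/-- All rounds of a run are accurate. -/
def AccurateRun (D : Fin k → Measure (X × Bool)) (O : ∀ n : ℕ, Sample X n → X → Bool)
    (a e θ : ℝ) : (r : ℕ) → (Fin r → RoundData X k nS nT) → Prop
  | 0, _ => True
  | r + 1, h => AccurateRun D O a e θ r (Fin.init h) ∧
      AccurateRound D O a e θ (weight O a e r (Fin.init h)) (h (Fin.last r)).1

theorem accurateRun_snoc (r : ℕ) (h : Fin r → RoundData X k nS nT) (ρ : RoundData X k nS nT) :
    AccurateRun D O a e θ (r + 1) (Fin.snoc (α := fun _ => RoundData X k nS nT) h ρ) ↔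
      AccurateRun D O a e θ r h ∧ AccurateRound D O a e θ (weight O a e r h) ρ.1 := by
  simp [AccurateRun]

theorem AccurateRun.empErr_le {r : ℕ} {h : Fin r → RoundData X k nS nT}
    (H : AccurateRun D O a e θ r h) (j : Fin r) : empErr (h j).1 (O nS (h j).1) ≤ θ := by
  induction r with
  | zero => exact j.elim0
  | succ r ih =>
    refine Fin.lastCases H.2.2 (fun j => ?_) j
    exact ih H.1 j

theorem measurable_init {Z : Type*} [MeasurableSpace Z] (r : ℕ) :
    Measurable fun h : Fin (r + 1) → Z => (Fin.init h : Fin r → Z) :=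
  measurable_pi_iff.2 fun j => measurable_pi_apply j.castSucc

variable [∀ i, IsProbabilityMeasure (D i)]

theorem measurable_err_mixture (hO : ∀ n : ℕ, Measurable fun p : Sample X n × X => O n p.1 p.2)
    {Y : Type*} [MeasurableSpace Y] {w : Y → Fin k → ℝ} {S : Y → Sample X nS}
    (hw : ∀ i, Measurable fun y => w y i) (hw0 : ∀ y i, 0 ≤ w y i) (hS : Measurable S) :
    Measurable fun y => err (mixture D (w y)) (O nS (S y)) := by
  simp only [fun y => err_mixture D (hw0 y)]
  exact (Finset.measurable_sum _ fun i _ => (hw i).mul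
    ((measurable_err_family (hO nS) (D i)).comp hS)).div (Finset.measurable_sum _ fun i _ => hw i)

theorem measurableSet_accurateRound
    (hO : ∀ n : ℕ, Measurable fun p : Sample X n × X => O n p.1 p.2)
    {Y : Type*} [MeasurableSpace Y] {w : Y → Fin k → ℝ} {S : Y → Sample X nS}
    (hw : ∀ i, Measurable fun y => w y i) (hw0 : ∀ y i, 0 ≤ w y i) (hS : Measurable S) :
    MeasurableSet {y | AccurateRound D O a e θ (w y) (S y)} :=
  (measurableSet_le (measurable_err_mixture hO hw hw0 hS) ((measurable_slack hO).comp hS)).inter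
    (measurableSet_le ((measurable_empErr_family (hO nS) measurable_id).comp hS) measurable_const)

theorem measurableSet_accurateRun
    (hO : ∀ n : ℕ, Measurable fun p : Sample X n × X => O n p.1 p.2) (ha : 0 < a) (he : 0 < e)
    (r : ℕ) : MeasurableSet {h : Fin r → RoundData X k nS nT | AccurateRun D O a e θ r h} := by
  induction r with
  | zero => exact MeasurableSet.univ
  | succ r ih =>
    have h1 : MeasurableSet {h : Fin (r + 1) → RoundData X k nS nT |
        AccurateRound D O a e θ (weight O a e r (Fin.init h)) (h (Fin.last r)).1} :=
      measurableSet_accurateRound hO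
        (w := fun h : Fin (r + 1) → RoundData X k nS nT => weight O a e r (Fin.init h))
        (S := fun h => (h (Fin.last r)).1)
        (fun i => (measurable_weight hO r i).comp (measurable_init r))
        (fun h i => (weight_pos ha he r _ i).le)
        (measurable_fst.comp (measurable_pi_apply (Fin.last r)))
    have h2 : {h : Fin (r + 1) → RoundData X k nS nT | AccurateRun D O a e θ (r + 1) h} =
        (fun h => (Fin.init h : Fin r → RoundData X k nS nT)) ⁻¹' {h | AccurateRun D O a e θ r h} ∩
        {h | AccurateRound D O a e θ (weight O a e r (Fin.init h)) (h (Fin.last r)).1} := rfl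
    rw [h2]
    exact (measurable_init r ih).inter h1

/-- A union bound over the rounds: the failure bound holds conditionally on every history, because
given the history the sample is i.i.d. from a fixed mixture. -/
theorem runLaw_not_accurateRun_le
    (hO : ∀ n : ℕ, Measurable fun p : Sample X n × X => O n p.1 p.2) (ha : 0 < a) (he : 0 < e)
    (hk : 1 ≤ k) {η : ENNReal}
    (hη : ∀ r (h : Fin r → RoundData X k nS nT),
      (Measure.pi fun _ : Fin nS => mixture D (weight O a e r h))
        {S | ¬AccurateRound D O a e θ (weight O a e r h) S} ≤ η) (r : ℕ) :
    runLaw D O a e r {h : Fin r → RoundData X k nS nT | ¬AccurateRun D O a e θ r h} ≤ r * η := by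
  induction r with
  | zero => simp [AccurateRun]
  | succ r ih =>
    have hm : ∀ r, MeasurableSet {h : Fin r → RoundData X k nS nT | ¬AccurateRun D O a e θ r h} :=
      fun r => (measurableSet_accurateRun hO ha he r).compl
    have := isProbabilityMeasure_runLaw (nS := nS) (nT := nT) D hO ha he hk r
    calc _ = ∫⁻ h, Set.indicator {h : Fin (r + 1) → RoundData X k nS nT |
          ¬AccurateRun D O a e θ (r + 1) h} 1 h ∂(runLaw D O a e (r + 1)) :=
          (lintegral_indicator_one (hm _)).symm
      _ ≤ _ := lintegral_runLaw_succ_le D r _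
      _ ≤ ∫⁻ h, Set.indicator {h : Fin r → RoundData X k nS nT |
          ¬AccurateRun D O a e θ r h} 1 h + η ∂(runLaw D O a e r) := by
        refine lintegral_mono fun h => ?_
        have := isProbabilityMeasure_mixture_weight (O := O) D ha he hk r h
        have := isProbabilityMeasure_roundLaw (O := O) D ha he hk r h
        have hB : MeasurableSet {S : Sample X nS |
            ¬AccurateRound D O a e θ (weight O a e r h) S} :=
          (measurableSet_accurateRound hO (w := fun _ => weight O a e r h) (S := fun S => S)
            (fun i => measurable_const) (fun _ i => (weight_pos ha he r h i).le)
            measurable_id).compl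
        have hB' := (measurable_fst : Measurable (Prod.fst : RoundData X k nS nT → _)) hB
        calc _ ≤ ∫⁻ ρ, Set.indicator {h : Fin r → RoundData X k nS nT |
              ¬AccurateRun D O a e θ r h} 1 h + Set.indicator (Prod.fst ⁻¹' {S : Sample X nS |
                ¬AccurateRound D O a e θ (weight O a e r h) S}) 1 ρ ∂(roundLaw D O a e r h) := by
              refine lintegral_mono fun ρ => ?_
              by_cases h1 : AccurateRun D O a e θ r h <;>
              by_cases h2 : AccurateRound D O a e θ (weight O a e r h) ρ.1 <;>
              simp [Set.indicator, accurateRun_snoc, h1, h2]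
          _ = Set.indicator {h : Fin r → RoundData X k nS nT | ¬AccurateRun D O a e θ r h} 1 h +
                roundLaw D O a e r h (Prod.fst ⁻¹' {S : Sample X nS |
                ¬AccurateRound D O a e θ (weight O a e r h) S}) := by
              rw [lintegral_add_left measurable_const, lintegral_indicator_one hB']
              simp
          _ ≤ _ := by
              refine add_le_add_right ?_ _
              rw [roundLaw, measurePreserving_fst.measure_preimage hB.nullMeasurableSet]
              exact hη r h
      _ = runLaw D O a e r {h : Fin r → RoundData X k nS nT | ¬AccurateRun D O a e θ r h} +
          η := by
        rw [lintegral_add_right _ measurable_const, lintegral_indicator_one (hm r)]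
        simp
      _ ≤ r * η + η := by gcongr
      _ = _ := by push_cast; ring

/-! ### The total weight -/

theorem integral_empErr_player (hT : 0 < nT) {f : X → Bool} (hf : Measurable f) (i : Fin k) :
    ∫ T : Fin k → Sample X nT, empErr (T i) f
      ∂(Measure.pi fun i : Fin k => Measure.pi fun _ : Fin nT => D i) = err (D i) f := by
  rw [integral_comp_eval (μ := fun i : Fin k => Measure.pi fun _ : Fin nT => D i) (i := i)
    (f := fun S : Sample X nT => empErr S f) (measurable_empErr hf).aestronglyMeasurable,
    integral_empErr hT _ hf]

theorem integrable_of_empErr_player {f : X → Bool} (hf : Measurable f) (i : Fin k) {g : ℝ → ℝ}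
    (hg : Measurable g) {C : ℝ} (hC : ∀ x, 0 ≤ x → x ≤ 1 → |g x| ≤ C) :
    Integrable (fun T : Fin k → Sample X nT => g (empErr (T i) f))
      (Measure.pi fun i : Fin k => Measure.pi fun _ : Fin nT => D i) :=
  Integrable.of_bound
    (hg.comp ((measurable_empErr hf).comp (measurable_pi_apply i))).aestronglyMeasurable C
    (Filter.Eventually.of_forall fun _ => hC _ (empErr_nonneg _ _) (empErr_le_one _ _))

theorem integrable_empErr_player {f : X → Bool} (hf : Measurable f) (i : Fin k) :
    Integrable (fun T : Fin k → Sample X nT => empErr (T i) f)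
      (Measure.pi fun i : Fin k => Measure.pi fun _ : Fin nT => D i) :=
  integrable_of_empErr_player hf i measurable_id (C := 1) fun x h0 h1 => by
    rwa [id, abs_of_nonneg h0]

/-- The mean increment of player `i` is proportional to `err (D i)`, so the mean gain in total
weight is `e a / slack` times the total weight times the mixture error. Accuracy says precisely that
this error is at most the slack, which cancels. -/
theorem lintegral_sum_weight_round_le
    (hO : ∀ n : ℕ, Measurable fun p : Sample X n × X => O n p.1 p.2) (ha : 0 < a) (he : 0 < e)
    (hT : 0 < nT) {w : Fin k → ℝ} (hw : ∀ i, 0 ≤ w i) (hW : 0 < ∑ i, w i) {S : Sample X nS}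
    (hS : AccurateRound D O a e θ w S) :
    ∫⁻ T : Fin k → Sample X nT, ENNReal.ofReal (∑ i, w i * (1 + increment O a e (S, T) i))
      ∂(Measure.pi fun i : Fin k => Measure.pi fun _ : Fin nT => D i) ≤
      ENNReal.ofReal (1 + e * a) * ENNReal.ofReal (∑ i, w i) := by
  have hf := measurable_family_apply (hO nS) S
  have hpos := slack_pos (O := O) ha he S
  have hint : ∀ i ∈ Finset.univ, Integrable (fun T : Fin k → Sample X nT =>
      w i * (1 + increment O a e (S, T) i))
      (Measure.pi fun i : Fin k => Measure.pi fun _ : Fin nT => D i) := by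
    intro i _
    simp only [increment_eq]
    exact ((integrable_const 1).add ((integrable_empErr_player hf i).mul_const _)).const_mul _
  rw [← ofReal_integral_eq_lintegral_ofReal (integrable_finsetSum _ hint)
    (Filter.Eventually.of_forall fun T => Finset.sum_nonneg fun i _ =>
      mul_nonneg (hw i) (by linarith [increment_nonneg (O := O) ha he (S, T) i])),
    ← ENNReal.ofReal_mul (by positivity), integral_finsetSum _ hint]
  apply ENNReal.ofReal_le_ofReal
  have h1 : ∀ i, ∫ T : Fin k → Sample X nT, w i * (1 + increment O a e (S, T) i)
      ∂(Measure.pi fun i : Fin k => Measure.pi fun _ : Fin nT => D i) =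
      w i + w i * err (D i) (O nS S) * (e * a / slack O a e S) := by
    intro i
    simp only [increment_eq]
    rw [integral_const_mul, integral_add (integrable_const 1)
      ((integrable_empErr_player hf i).mul_const _), integral_mul_const,
      integral_empErr_player hT hf i]
    simp
    ring
  simp only [h1]
  rw [Finset.sum_add_distrib, ← Finset.sum_mul]
  have h2 := hS.1
  rw [err_mixture D hw, div_le_iff₀ hW] at h2
  have h3 : (∑ i, w i * err (D i) (O nS S)) * (e * a / slack O a e S) ≤
      slack O a e S * (∑ i, w i) * (e * a / slack O a e S) :=
    mul_le_mul_of_nonneg_right h2 (by positivity)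
  have h4 : slack O a e S * (∑ i, w i) * (e * a / slack O a e S) = e * a * ∑ i, w i := by
    field_simp
  linarith

/-- The indicator stops the process at the first inaccurate round, so the one-step growth bound
holds unconditionally. The initial total weight gives the factor `k`. -/
theorem lintegral_indicator_sum_weight_le
    (hO : ∀ n : ℕ, Measurable fun p : Sample X n × X => O n p.1 p.2) (ha : 0 < a) (he : 0 < e)
    (hk : 1 ≤ k) (hT : 0 < nT) (r : ℕ) :
    ∫⁻ h, Set.indicator {h : Fin r → RoundData X k nS nT | AccurateRun D O a e θ r h}
      (fun h => ENNReal.ofReal (∑ i, weight O a e r h i)) h ∂(runLaw D O a e r) ≤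
      ENNReal.ofReal (1 + e * a) ^ r * k := by
  refine (lintegral_runLaw_le D (fun r h => Set.indicator
    {h : Fin r → RoundData X k nS nT | AccurateRun D O a e θ r h}
      (fun h => ENNReal.ofReal (∑ i, weight O a e r h i)) h) (ENNReal.ofReal (1 + e * a)) ?_
      ENNReal.ofReal_ne_top r).trans_eq ?_
  · intro r h
    by_cases h1 : AccurateRun D O a e θ r h
    · have := isProbabilityMeasure_mixture_weight (O := O) D ha he hk r h
      have hW := sum_weight_pos (O := O) ha he hk r h
      have key : ∀ ρ : RoundData X k nS nT, Set.indicator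
          {h : Fin (r + 1) → RoundData X k nS nT | AccurateRun D O a e θ (r + 1) h}
          (fun h => ENNReal.ofReal (∑ i, weight O a e (r + 1) h i))
          (Fin.snoc (α := fun _ => RoundData X k nS nT) h ρ) =
          Set.indicator {ρ : RoundData X k nS nT |
            AccurateRound D O a e θ (weight O a e r h) ρ.1} (fun ρ => ENNReal.ofReal
            (∑ i, weight O a e r h i * (1 + increment O a e ρ i))) ρ := by
        intro ρ
        by_cases h2 : AccurateRound D O a e θ (weight O a e r h) ρ.1
        · rw [Set.indicator_of_mem (s := {h : Fin (r + 1) → RoundData X k nS nT | AccurateRun D O a e θ (r + 1) h})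
            ((accurateRun_snoc r h ρ).2 ⟨h1, h2⟩),
            Set.indicator_of_mem (s := {ρ : RoundData X k nS nT |
            AccurateRound D O a e θ (weight O a e r h) ρ.1}) h2]
          simp only [weight_snoc]
        · rw [Set.indicator_of_notMem (s := {h : Fin (r + 1) → RoundData X k nS nT | AccurateRun D O a e θ (r + 1) h})
            fun h3 => h2 ((accurateRun_snoc r h ρ).1 h3).2,
            Set.indicator_of_notMem (s := {ρ : RoundData X k nS nT |
            AccurateRound D O a e θ (weight O a e r h) ρ.1}) h2]
      simp only [key]
      rw [Set.indicator_of_mem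
        (s := {h : Fin r → RoundData X k nS nT | AccurateRun D O a e θ r h}) h1]
      refine (lintegral_prod_le _).trans ?_
      refine (lintegral_mono (g := fun _ => ENNReal.ofReal (1 + e * a) *
        ENNReal.ofReal (∑ i, weight O a e r h i)) fun S => ?_).trans (by simp)
      by_cases h2 : AccurateRound D O a e θ (weight O a e r h) S
      · refine le_trans (lintegral_mono fun T => Set.indicator_le_self _ _ _)
          (lintegral_sum_weight_round_le hO ha he hT (fun i => (weight_pos ha he r h i).le) hW h2)
      · simp [Set.indicator, h2]
    · simp [Set.indicator, accurateRun_snoc, h1]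
  · simp [AccurateRun, weight]

/-! ### The weight of one player -/

/-- The conditional expectation of the increment of player `i`, given the sample from the
mixture. -/
noncomputable def meanIncrement (D : Fin k → Measure (X × Bool))
    (O : ∀ n : ℕ, Sample X n → X → Bool) (a e : ℝ) (S : Sample X nS) (i : Fin k) : ℝ :=
  err (D i) (O nS S) * (e * a / slack O a e S)

/-- For `0 ≤ s ≤ a / 3` one has `(1 + s)⁻¹ ≤ 1 - (1 - a / 3) s`, which is linear in `s`. Its mean
over `T` depends only on the mean increment `m`, and `1 - y ≤ exp (-y)` finishes with `y = (1 - a /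
3) m`. -/
theorem lintegral_inv_one_add_increment_le
    (hO : ∀ n : ℕ, Measurable fun p : Sample X n × X => O n p.1 p.2) (ha : 0 < a) (ha1 : a ≤ 1)
    (he : 0 < e) (hT : 0 < nT) (S : Sample X nS) (i : Fin k) :
    ∫⁻ T : Fin k → Sample X nT, ENNReal.ofReal ((1 + increment O a e (S, T) i)⁻¹ *
      Real.exp ((1 - a / 3) * meanIncrement D O a e S i))
      ∂(Measure.pi fun i : Fin k => Measure.pi fun _ : Fin nT => D i) ≤ 1 := by
  have hf := measurable_family_apply (hO nS) S
  set c := e * a / slack O a e S with hc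
  have hc0 : 0 ≤ c := by
    have := slack_pos (O := O) ha he S
    positivity
  set m := meanIncrement D O a e S i with hm
  calc _ ≤ ∫⁻ T : Fin k → Sample X nT, ENNReal.ofReal ((1 - (1 - a / 3) *
          (empErr (T i) (O nS S) * c)) * Real.exp ((1 - a / 3) * m))
          ∂(Measure.pi fun i : Fin k => Measure.pi fun _ : Fin nT => D i) := by
        refine lintegral_mono fun T => ENNReal.ofReal_le_ofReal ?_
        refine mul_le_mul_of_nonneg_right ?_ (Real.exp_pos _).le
        have h0 := increment_nonneg (O := O) ha he (S, T) i
        have h1 := increment_le (O := O) ha he (S, T) i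
        rw [← show increment O a e (S, T) i = empErr (T i) (O nS S) * c from increment_eq _ _,
          inv_le_iff_one_le_mul₀' (by linarith)]
        nlinarith [mul_nonneg h0 (sub_nonneg.2 h1), mul_nonneg (mul_nonneg h0 h0) ha.le]
    _ = ENNReal.ofReal ((1 - (1 - a / 3) * m) * Real.exp ((1 - a / 3) * m)) := by
        have hi := (integrable_empErr_player (nT := nT) (D := D) hf i).mul_const c
        rw [← ofReal_integral_eq_lintegral_ofReal]
        · rw [integral_mul_const, integral_sub (integrable_const 1) (hi.const_mul _),
            integral_const_mul, integral_mul_const, integral_empErr_player hT hf i]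
          simp [hm, meanIncrement, hc]
        · exact ((integrable_const 1).sub (hi.const_mul _)).mul_const _
        · refine Filter.Eventually.of_forall fun T => mul_nonneg ?_ (Real.exp_pos _).le
          have h0 := increment_nonneg (O := O) ha he (S, T) i
          have h1 := increment_le (O := O) ha he (S, T) i
          rw [← show increment O a e (S, T) i = empErr (T i) (O nS S) * c from increment_eq _ _]
          nlinarith
    _ ≤ ENNReal.ofReal 1 := by
        apply ENNReal.ofReal_le_ofReal
        have h1 := Real.add_one_le_exp (-((1 - a / 3) * m))
        rw [Real.exp_neg] at h1
        have h2 := mul_le_mul_of_nonneg_right h1 (Real.exp_pos ((1 - a / 3) * m)).le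
        rw [inv_mul_cancel₀ (Real.exp_pos _).ne'] at h2
        linarith
    _ = 1 := ENNReal.ofReal_one

/-- By Markov's inequality, `exp ((1 - a / 3) ∑ m)` exceeds `M` times the final weight with
probability at most `1 / M`. No accuracy of the rounds is needed for this half. -/
theorem lintegral_prod_inv_one_add_increment_le
    (hO : ∀ n : ℕ, Measurable fun p : Sample X n × X => O n p.1 p.2) (ha : 0 < a) (ha1 : a ≤ 1)
    (he : 0 < e) (hk : 1 ≤ k) (hT : 0 < nT) (r : ℕ) (i : Fin k) :
    ∫⁻ h : Fin r → RoundData X k nS nT, ∏ j, ENNReal.ofReal ((1 + increment O a e (h j) i)⁻¹ *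
      Real.exp ((1 - a / 3) * meanIncrement D O a e (h j).1 i)) ∂(runLaw D O a e r) ≤ 1 := by
  refine (lintegral_runLaw_le D (fun r (h : Fin r → RoundData X k nS nT) =>
    ∏ j, ENNReal.ofReal ((1 + increment O a e (h j) i)⁻¹ *
      Real.exp ((1 - a / 3) * meanIncrement D O a e (h j).1 i))) 1 ?_
      ENNReal.one_ne_top r).trans_eq (by simp)
  intro r h
  have := isProbabilityMeasure_mixture_weight (O := O) D ha he hk r h
  simp only [Fin.prod_univ_castSucc, Fin.snoc_castSucc, Fin.snoc_last]
  rw [lintegral_const_mul', one_mul]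
  · refine mul_le_of_le_one_right' ((lintegral_prod_le _).trans ?_)
    exact (lintegral_mono fun S =>
      lintegral_inv_one_add_increment_le hO ha ha1 he hT S i).trans (by simp)
  · exact ENNReal.prod_ne_top fun j _ => ENNReal.ofReal_ne_top

end

section

variable {X : Type*} [MeasurableSpace X]

/-! ### The error of the output -/

theorem expectedErr_mixClassifier (D : Measure (X × Bool)) [IsProbabilityMeasure D] {t : ℕ}
    {f : Fin t → X → Bool} (hf : ∀ r, Measurable (f r)) :
    expectedErr D (mixClassifier f) = (∑ r, err D (f r)) / t := by
  have h1 : ∀ z : X × Bool, mixClassifier f z.1 {b | b ≠ z.2} =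
      (∑ r, Set.indicator {z : X × Bool | f r z.1 ≠ z.2} 1 z) * (t : ENNReal)⁻¹ := by
    intro z
    rw [mixClassifier, Measure.map_apply (measurable_of_finite _) (Set.toFinite _).measurableSet,
      uniformOn_univ, Fintype.card_fin, div_eq_mul_inv]
    congr 1
    rw [← lintegral_indicator_one (MeasurableSet.of_discrete), lintegral_count, tsum_fintype]
    rfl
  unfold expectedErr
  simp only [h1]
  have hm : ∀ r ∈ Finset.univ, Measurable
      (Set.indicator {z : X × Bool | f r z.1 ≠ z.2} (1 : X × Bool → ENNReal)) := fun r _ =>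
    measurable_one.indicator (measurableSet_mislabelled (hf r))
  rw [lintegral_mul_const _ (Finset.measurable_sum _ hm), lintegral_finsetSum _ hm,
    ENNReal.toReal_mul, ENNReal.toReal_inv, ENNReal.toReal_natCast, ← div_eq_mul_inv]
  congr 1
  rw [ENNReal.toReal_sum]
  · exact Finset.sum_congr rfl fun r _ => by
      rw [lintegral_indicator_one (measurableSet_mislabelled (hf r)), err, measureReal_def]
  · intro r _
    rw [lintegral_indicator_one (measurableSet_mislabelled (hf r))]
    exact measure_ne_top _ _

variable {k nS nT : ℕ} {O : ∀ n : ℕ, Sample X n → X → Bool} {a e θ : ℝ}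
  {D : Fin k → Measure (X × Bool)}

/-- The potential argument: if all rounds are accurate, the total weight is small, and the weight
of player `i` is large in terms of the mean increments, then player `i` has small average error. -/
theorem average_err_le {t : ℕ} (ht : 0 < t) {h : Fin t → RoundData X k nS nT} (ha : 0 < a)
    (ha1 : a ≤ 1) (he : 0 < e) {M : ℝ} (hM : 0 < M)
    (hlog : Real.log M ≤ e * a ^ 2 * t / 2) (hacc : AccurateRun D O a e θ t h)
    (hW : ∑ i, weight O a e t h i ≤ M * (1 + e * a) ^ t) (i : Fin k)
    (hi : ∏ j, ((1 + increment O a e (h j) i)⁻¹ *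
      Real.exp ((1 - a / 3) * meanIncrement D O a e (h j).1 i)) ≤ M) :
    (∑ j, err (D i) (O nS (h j).1)) / t ≤
      (1 + a) / (1 - a / 3) * ((1 + 3 * a) * θ + 3 * e) := by
  have ht' : (0 : ℝ) < t := by exact_mod_cast ht
  have hb : 0 < 1 - a / 3 := by linarith
  set s := ∑ j, meanIncrement D O a e (h j).1 i with hs
  set w := weight O a e t h i with hw
  have hw0 : 0 < w := weight_pos ha he t h i
  rw [Finset.prod_mul_distrib, Finset.prod_inv_distrib, ← weight_eq_prod, ← Real.exp_sum,
    ← Finset.mul_sum, ← hw, ← hs, inv_mul_le_iff₀ hw0] at hi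
  have hwle : w ≤ M * Real.exp (t * (e * a)) := by
    refine (Finset.single_le_sum (fun i _ => (weight_pos (O := O) ha he t h i).le)
      (Finset.mem_univ i)).trans (hW.trans ?_)
    rw [Real.exp_nat_mul]
    gcongr
    linarith [Real.add_one_le_exp (e * a)]
  -- Each potential loses one factor `M`; the assumption on `log M` then turns the two logarithms
  -- into at most `e a t * a`, a relative loss of `a` against the main term `e a t`.
  have hexp : Real.exp ((1 - a / 3) * s) ≤
      Real.exp (Real.log M + t * (e * a) + Real.log M) := by
    rw [Real.exp_add, Real.exp_add, Real.exp_log hM]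
    exact hi.trans (mul_le_mul_of_nonneg_right hwle hM.le)
  have hs1 := Real.exp_le_exp.1 hexp
  set Γ := (1 + 3 * a) * θ + 3 * e with hΓ
  have hslack : ∀ j, slack O a e (h j).1 ≤ Γ := by
    intro j
    have := hacc.empErr_le j
    unfold slack
    rw [hΓ]
    gcongr
  have hΓ0 : 0 < Γ := (slack_pos ha he (h ⟨0, ht⟩).1).trans_le (hslack ⟨0, ht⟩)
  -- The slack varies with the round, and the uniform bound `Γ` is what allows the mean increments
  -- to be traded for plain errors.
  have hsum : (∑ j, err (D i) (O nS (h j).1)) * (e * a / Γ) ≤ s := by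
    rw [Finset.sum_mul, hs]
    refine Finset.sum_le_sum fun j _ => ?_
    have := slack_pos (O := O) ha he (h j).1
    exact mul_le_mul_of_nonneg_left (div_le_div_of_nonneg_left (by positivity) this (hslack j))
      (err_nonneg _ _)
  have hea : 0 < e * a := by positivity
  have h1 : (1 - a / 3) * ((∑ j, err (D i) (O nS (h j).1)) * (e * a / Γ)) ≤
      e * a * t * (1 + a) := by
    refine (mul_le_mul_of_nonneg_left hsum hb.le).trans (hs1.trans ?_)
    nlinarith
  rw [div_le_iff₀ ht', div_mul_eq_mul_div, div_mul_eq_mul_div, le_div_iff₀ hb]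
  have h2 : (∑ j, err (D i) (O nS (h j).1)) * (1 - a / 3) * (e * a) ≤
      (1 + a) * Γ * t * (e * a) := by
    have h3 : (1 - a / 3) * ((∑ j, err (D i) (O nS (h j).1)) * (e * a / Γ)) =
      (∑ j, err (D i) (O nS (h j).1)) * (1 - a / 3) * (e * a) / Γ := by ring
    rw [h3, div_le_iff₀ hΓ0] at h1
    linarith
  exact le_of_mul_le_mul_right h2 hea

variable [∀ i, IsProbabilityMeasure (D i)]

theorem measure_gt_le_of_lintegral_le {Ω : Type*} [MeasurableSpace Ω] {μ : Measure Ω}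
    {φ : Ω → ENNReal} (hφ : Measurable φ) {B c : ENNReal} (hB : B ≠ 0) (hB' : B ≠ ⊤)
    (h : ∫⁻ ω, φ ω ∂μ ≤ B * c) : μ {ω | B < φ ω} ≤ c := by
  have h1 := (mul_meas_ge_le_lintegral hφ B (μ := μ)).trans h
  exact (measure_mono fun ω (hω : B < φ ω) => hω.le).trans
    ((ENNReal.mul_le_mul_iff_right hB hB').1 h1)

/-- The three sources of failure: an inaccurate round (`t * η`), a total weight above `M / k` times
its bound in mean (`k / M`), and some player's potential above `M` (`1 / M` for each of the `k`
players). -/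
theorem runLaw_average_err_le
    (hO : ∀ n : ℕ, Measurable fun p : Sample X n × X => O n p.1 p.2) (ha : 0 < a) (ha1 : a ≤ 1)
    (he : 0 < e) (hk : 1 ≤ k) (hT : 0 < nT) {η : ℝ} (hη0 : 0 ≤ η)
    (hη : ∀ r (h : Fin r → RoundData X k nS nT),
      (Measure.pi fun _ : Fin nS => mixture D (weight O a e r h)).real
        {S | ¬AccurateRound D O a e θ (weight O a e r h) S} ≤ η)
    {t : ℕ} (ht : 0 < t) {M : ℝ} (hM : 0 < M) (hlog : Real.log M ≤ e * a ^ 2 * t / 2) :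
    ENNReal.ofReal (1 - (t * η + 2 * (k / M))) ≤
      runLaw D O a e t {h : Fin t → RoundData X k nS nT | ∀ i,
        (∑ j, err (D i) (O nS (h j).1)) / t ≤
          (1 + a) / (1 - a / 3) * ((1 + 3 * a) * θ + 3 * e)} := by
  have := isProbabilityMeasure_runLaw (nS := nS) (nT := nT) D hO ha he hk t
  set μ : Measure (Fin t → RoundData X k nS nT) := runLaw D O a e t
  have hβ : 0 < M * (1 + e * a) ^ t := by positivity
  let φ : (Fin t → RoundData X k nS nT) → ENNReal := Set.indicator
    {h | AccurateRun D O a e θ t h} fun h => ENNReal.ofReal (∑ i, weight O a e t h i)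
  let ψ : Fin k → (Fin t → RoundData X k nS nT) → ENNReal := fun i h =>
    ∏ j, ENNReal.ofReal ((1 + increment O a e (h j) i)⁻¹ *
      Real.exp ((1 - a / 3) * meanIncrement D O a e (h j).1 i))
  have hφ : Measurable φ :=
    (Finset.measurable_sum _ fun i _ => measurable_weight hO t i).ennreal_ofReal.indicator
      (measurableSet_accurateRun hO ha he t)
  have hψ : ∀ i, Measurable (ψ i) := by
    intro i
    refine Finset.measurable_prod _ fun j _ => Measurable.ennreal_ofReal ?_
    have h1 : Measurable fun h : Fin t → RoundData X k nS nT => increment O a e (h j) i :=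
      (measurable_increment hO i).comp (measurable_pi_apply j)
    have h2 : Measurable fun S : Sample X nS => meanIncrement D O a e S i :=
      (measurable_err_family (hO nS) (D i)).mul ((measurable_slack hO).const_div _)
    exact (h1.const_add 1).inv.mul (Real.measurable_exp.comp
      ((h2.comp (measurable_fst.comp (measurable_pi_apply j))).const_mul _))
  have b1 : μ {h | ¬AccurateRun D O a e θ t h} ≤ ENNReal.ofReal (t * η) := by
    rw [ENNReal.ofReal_mul (by positivity), ENNReal.ofReal_natCast]
    refine runLaw_not_accurateRun_le hO ha he hk (fun r h => ?_) t
    have := isProbabilityMeasure_mixture_weight (O := O) D ha he hk r h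
    rw [← ENNReal.ofReal_toReal (measure_ne_top _ _)]
    exact ENNReal.ofReal_le_ofReal (hη r h)
  have b2 : μ {h | ENNReal.ofReal (M * (1 + e * a) ^ t) < φ h} ≤ ENNReal.ofReal (k / M) := by
    refine measure_gt_le_of_lintegral_le hφ (ENNReal.ofReal_pos.2 hβ).ne' ENNReal.ofReal_ne_top ?_
    refine (lintegral_indicator_sum_weight_le hO ha he hk hT t).trans_eq ?_
    rw [← ENNReal.ofReal_mul hβ.le, ← ENNReal.ofReal_pow (by positivity),
      ← ENNReal.ofReal_natCast k, ← ENNReal.ofReal_mul (by positivity)]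
    congr 1
    field_simp
  have b3 : ∀ i, μ {h | ENNReal.ofReal M < ψ i h} ≤ ENNReal.ofReal (1 / M) := by
    intro i
    refine measure_gt_le_of_lintegral_le (hψ i) (ENNReal.ofReal_pos.2 hM).ne'
      ENNReal.ofReal_ne_top ?_
    refine (lintegral_prod_inv_one_add_increment_le hO ha ha1 he hk hT t i).trans_eq ?_
    rw [← ENNReal.ofReal_mul hM.le, mul_one_div_cancel hM.ne', ENNReal.ofReal_one]
  have b3' : μ (⋃ i, {h | ENNReal.ofReal M < ψ i h}) ≤ ENNReal.ofReal (k / M) := by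
    refine (measure_iUnion_fintype_le _ _).trans ((Finset.sum_le_sum fun i _ => b3 i).trans_eq ?_)
    rw [Finset.sum_const, Finset.card_univ, Fintype.card_fin, nsmul_eq_mul,
      ← ENNReal.ofReal_natCast k, ← ENNReal.ofReal_mul (by positivity)]
    congr 1
    field_simp
  set target := {h : Fin t → RoundData X k nS nT | ∀ i,
        (∑ j, err (D i) (O nS (h j).1)) / t ≤
          (1 + a) / (1 - a / 3) * ((1 + 3 * a) * θ + 3 * e)}
  have hcover : (Set.univ : Set (Fin t → RoundData X k nS nT)) ⊆
      target ∪ ({h | ¬AccurateRun D O a e θ t h} ∪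
        ({h | ENNReal.ofReal (M * (1 + e * a) ^ t) < φ h} ∪
          ⋃ i, {h | ENNReal.ofReal M < ψ i h})) := by
    intro h _
    by_contra hcon
    simp only [Set.mem_union, Set.mem_iUnion, Set.mem_ofPred_eq, not_or, not_exists, not_not,
      not_lt] at hcon
    obtain ⟨h0, hacc, hW, hi⟩ := hcon
    refine h0 fun i => average_err_le ht ha ha1 he hM hlog hacc ?_ i ?_
    · simp only [φ] at hW
      rw [Set.indicator_of_mem (s := {h | AccurateRun D O a e θ t h}) hacc] at hW
      exact (ENNReal.ofReal_le_ofReal_iff hβ.le).1 hW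
    · have := hi i
      simp only [ψ] at this
      rw [← ENNReal.ofReal_prod_of_nonneg] at this
      · exact (ENNReal.ofReal_le_ofReal_iff hM.le).1 this
      · intro j _
        have := increment_nonneg (O := O) ha he (h j) i
        positivity
  have hfin : (1 : ENNReal) ≤ μ target + ENNReal.ofReal (t * η + 2 * (k / M)) := by
    have hkM : 0 ≤ k / M := by positivity
    calc (1 : ENNReal) = μ Set.univ := measure_univ.symm
      _ ≤ _ := measure_mono hcover
      _ ≤ μ target + (ENNReal.ofReal (t * η) + (ENNReal.ofReal (k / M) +
          ENNReal.ofReal (k / M))) := by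
        refine (measure_union_le _ _).trans (add_le_add le_rfl ?_)
        refine (measure_union_le _ _).trans (add_le_add b1 ?_)
        exact (measure_union_le _ _).trans (add_le_add b2 b3')
      _ = _ := by
        rw [← ENNReal.ofReal_add hkM hkM, ← ENNReal.ofReal_add (by positivity) (by positivity)]
        congr 3
        ring
  rw [ENNReal.ofReal_sub _ (by positivity), ENNReal.ofReal_one]
  exact tsub_le_iff_right.2 hfin

/-- Every round is accurate with high probability. -/
theorem measureReal_not_accurateRound_le {d : ℕ} {F : Set (X → Bool)} (hd : vcDim F ≤ d)
    (hF : ∀ f ∈ F, Measurable f) (hERM : IsERM F O)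
    (hO : ∀ n : ℕ, Measurable fun p : Sample X n × X => O n p.1 p.2) (ha : 0 < a)
    (ha1 : a ≤ 1 / 3) (he : 0 < e) (he1 : e ≤ 1) (hn : 0 < nS) (hne : 1 ≤ a * e * nS)
    {f : X → Bool} (hf : f ∈ F) {q : ℝ} (hq : ∀ i, err (D i) f ≤ q) {w : Fin k → ℝ}
    (hw : ∀ i, 0 ≤ w i) (hW : 0 < ∑ i, w i) :
    (Measure.pi fun _ : Fin nS => mixture D w).real
        {S | ¬AccurateRound D O a e ((1 + a) * q + e) w S} ≤
      2 * (16 / (a * e)) ^ d * Real.exp (-(a * e * nS / 8)) + Real.exp (-(a * e * nS)) := by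
  have := isProbabilityMeasure_mixture D hw hW
  have h1 := measureReal_err_gt_le hd (fun S => (hERM nS S).1) (hO nS) ha ha1 he he1 hn hne
    (mixture D w)
  have h2 := chernoff_empErr (mixture D w) (hF f hf) (l := a) (c := a * e)
    (by rw [abs_of_pos ha]; linarith) hn
  have hmix : err (mixture D w) f ≤ q := by
    rw [err_mixture D hw, div_le_iff₀ hW, Finset.mul_sum]
    exact Finset.sum_le_sum fun i _ => by nlinarith [hw i, hq i]
  refine le_trans (measureReal_mono ?_) ((measureReal_union_le _ _).trans (add_le_add h1 h2))
  intro S hS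
  by_contra hcon
  simp only [Set.mem_union, Set.mem_ofPred_eq, not_or, not_lt, not_le] at hcon
  refine hS ⟨hcon.1, ?_⟩
  -- The comparison classifier `f` is fixed before `S` is drawn, so a single Chernoff bound controls
  -- the empirical error of the minimizer from above.
  have h3 := (hERM nS S).2 f hf
  have h4 : empErr S f - err (mixture D w) f < a * err (mixture D w) f + e := by
    have : a * (empErr S f - err (mixture D w) f) < a * (a * err (mixture D w) f + e) := by
      linarith [hcon.2]
    exact lt_of_mul_lt_mul_left this ha.le
  nlinarith

end

/-! ### The parameters of the algorithm -/

section

variable {α ε δ : ℝ} {k : ℕ}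

theorem log_four_mul_div_pos (hk : 1 ≤ k) (hδ : 0 < δ) (hδ1 : δ < 1) :
    0 < Real.log (4 * k / δ) := by
  apply Real.log_pos
  rw [one_lt_div hδ]
  have : (1 : ℝ) ≤ k := by exact_mod_cast hk
  linarith

theorem rounds_pos (hk : 1 ≤ k) (hδ : 0 < δ) (hδ1 : δ < 1) (hε : 0 < ε) (hα : 0 < α) :
    0 < rounds k α ε δ := by
  have h := log_four_mul_div_pos hk hδ hδ1
  have : 0 < ⌈Real.log (4 * k / δ) / (innerEps ε * innerAlpha α ^ 2)⌉₊ := by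
    apply Nat.ceil_pos.2
    unfold innerEps innerAlpha
    positivity
  unfold rounds
  omega

theorem log_le_rounds (hε : 0 < ε) (hα : 0 < α) :
    Real.log (4 * k / δ) ≤ innerEps ε * innerAlpha α ^ 2 * rounds k α ε δ / 2 := by
  have h := Nat.le_ceil (Real.log (4 * k / δ) / (innerEps ε * innerAlpha α ^ 2))
  have hpos : 0 < innerEps ε * innerAlpha α ^ 2 := by
    unfold innerEps innerAlpha; positivity
  rw [div_le_iff₀ hpos] at h
  unfold rounds
  push_cast
  linarith

/-- The failure probability of a round in terms of the size of the sample. -/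
theorem round_failure_le {a e δ' c : ℝ} {d n : ℕ} (ha : e ≤ a) (he : 0 < e) (he1 : e ≤ 1 / 16)
    (hδ : 0 < δ') (hδ1 : δ' ≤ 1 / 3) (hc : 24 ≤ c)
    (hn : c / (a * e) * (d * Real.log (1 / e) + Real.log (1 / δ')) ≤ n) :
    0 < n ∧ 1 ≤ a * e * n ∧ 2 * (16 / (a * e)) ^ d * Real.exp (-(a * e * n / 8)) +
      Real.exp (-(a * e * n)) ≤ 2 * δ' := by
  have ha0 : 0 < a := by linarith
  have hae : 0 < a * e := by positivity
  have hL : 0 ≤ Real.log (1 / e) := Real.log_nonneg (by rw [le_div_iff₀ he]; linarith)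
  have hD : 1 ≤ Real.log (1 / δ') := by
    rw [Real.le_log_iff_exp_le (by positivity), le_div_iff₀ hδ]
    nlinarith [Real.exp_one_lt_d9, Real.exp_pos (1 : ℝ)]
  have h1 : 24 * (d * Real.log (1 / e) + Real.log (1 / δ')) ≤ a * e * n := by
    rw [div_mul_eq_mul_div, div_le_iff₀ hae] at hn
    have : 24 * (d * Real.log (1 / e) + Real.log (1 / δ')) ≤
        c * (d * Real.log (1 / e) + Real.log (1 / δ')) := by gcongr
    linarith
  have hdL : 0 ≤ d * Real.log (1 / e) := by positivity
  have hne : 1 ≤ a * e * n := by linarith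
  have hn0 : 0 < n := by
    rcases Nat.eq_zero_or_pos n with h | h
    · rw [h] at hne; norm_num at hne
    · exact h
  have hexp : Real.exp (-Real.log (1 / δ')) = δ' := by
    rw [Real.exp_neg, Real.exp_log (by positivity), one_div, inv_inv]
  refine ⟨hn0, hne, ?_⟩
  have h2 : Real.exp (-(a * e * n)) ≤ δ' := by
    rw [← hexp]
    exact Real.exp_le_exp.2 (by linarith)
  -- From `e ≤ a` and `e ≤ 1 / 16`: the left side is at most `16 / e²`, hence at most `1 / e³`.
  have h3 : 16 / (a * e) ≤ Real.exp (3 * Real.log (1 / e)) := by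
    have : Real.exp (3 * Real.log (1 / e)) = (1 / e) ^ 3 := by
      rw [show (3 : ℝ) = ((3 : ℕ) : ℝ) by norm_num, Real.exp_nat_mul,
        Real.exp_log (by positivity)]
    rw [this, div_pow, one_pow, div_le_div_iff₀ hae (by positivity)]
    nlinarith [mul_le_mul_of_nonneg_right ha he.le, mul_pos he he, mul_pos (mul_pos he he) he]
  have h4 : (16 / (a * e)) ^ d ≤ Real.exp (d * (3 * Real.log (1 / e))) := by
    rw [Real.exp_nat_mul]
    gcongr
  have h5 : (2 : ℝ) ≤ Real.exp (2 * Real.log (1 / δ')) := by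
    linarith [Real.add_one_le_exp (2 * Real.log (1 / δ'))]
  -- The constant `24 = 8 * 3` is spent here: three multiples of `d * log (1 / e)` pay for the
  -- growth function, and of three multiples of `log (1 / δ')` two pay for the factor `2` and one
  -- remains.
  have h6 : 2 * (16 / (a * e)) ^ d * Real.exp (-(a * e * n / 8)) ≤ δ' := by
    calc _ ≤ Real.exp (2 * Real.log (1 / δ')) * Real.exp (d * (3 * Real.log (1 / e))) *
          Real.exp (-(a * e * n / 8)) := by gcongr
      _ = Real.exp (2 * Real.log (1 / δ') + d * (3 * Real.log (1 / e)) + -(a * e * n / 8)) := by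
          rw [Real.exp_add, Real.exp_add]
      _ ≤ Real.exp (-Real.log (1 / δ')) := Real.exp_le_exp.2 (by linarith)
      _ = δ' := hexp
  linarith

/-- Explains the rescalings `α / 15` and `ε / 29`: the coefficients of `x` and of `e` are compared
separately, and both inequalities have room to spare on `a ≤ 1 / 15`. -/
theorem error_bound_le {a e x : ℝ} (ha : 0 ≤ a) (ha1 : a ≤ 1 / 15) (he : 0 ≤ e) (hx : 0 ≤ x) :
    (1 + a) / (1 - a / 3) * ((1 + 3 * a) * ((1 + a) * (x + e) + e) + 3 * e) ≤
      (1 + 15 * a) * x + 29 * e := by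
  rw [div_mul_eq_mul_div, div_le_iff₀ (by linarith)]
  have h1 : (1 + a) * (1 + 3 * a) * (1 + a) ≤ (1 + 15 * a) * (1 - a / 3) := by
    nlinarith [mul_nonneg ha ha, mul_nonneg (mul_nonneg ha ha) (sub_nonneg.2 ha1),
      mul_nonneg ha (sub_nonneg.2 ha1)]
  have h2 : (1 + a) * ((1 + 3 * a) * (2 + a) + 3) ≤ 29 * (1 - a / 3) := by
    nlinarith [mul_nonneg ha ha, mul_nonneg (mul_nonneg ha ha) (sub_nonneg.2 ha1),
      mul_nonneg ha (sub_nonneg.2 ha1)]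
  nlinarith [mul_le_mul_of_nonneg_right h1 hx, mul_le_mul_of_nonneg_right h2 he]

theorem opt_nonneg {X : Type*} [MeasurableSpace X] (D : Fin k → Measure (X × Bool))
    (F : Set (X → Bool)) : 0 ≤ opt D F :=
  Real.iInf_nonneg fun f => Real.iSup_nonneg fun i => err_nonneg (D i) f

theorem exists_err_le_opt_add {X : Type*} [MeasurableSpace X] (D : Fin k → Measure (X × Bool))
    {F : Set (X → Bool)} (hF : F.Nonempty) {η : ℝ} (hη : 0 < η) :
    ∃ f ∈ F, ∀ i, err (D i) f ≤ opt D F + η := by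
  have : Nonempty F := hF.to_subtype
  obtain ⟨f, hf⟩ := exists_lt_of_ciInf_lt
    (show (⨅ f : F, ⨆ i : Fin k, err (D i) f) < opt D F + η by unfold opt; linarith)
  exact ⟨f, f.2, fun i => (le_ciSup (f := fun i => err (D i) f)
    (Set.finite_range _).bddAbove i).trans hf.le⟩

theorem nr2avg_error {X : Type*} [MeasurableSpace X] {F : Set (X → Bool)} {d : ℕ}
    {O : ∀ n : ℕ, Sample X n → X → Bool} {D : Fin k → Measure (X × Bool)}
    [∀ i, IsProbabilityMeasure (D i)] {cS cT : ℝ} (hcS : 24 ≤ cS) (hcT : 0 < cT)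
    (hne : F.Nonempty) (hF : ∀ f ∈ F, Measurable f) (hd : vcDim F ≤ d) (hERM : IsERM F O)
    (hO : ∀ n : ℕ, Measurable fun p : Sample X n × X => O n p.1 p.2) (hk : 1 ≤ k) (hε : 0 < ε)
    (hδ : 0 < δ) (hδ1 : δ < 1) (hα : 30 * ε / 29 < α) (hα1 : α < 1) :
    ENNReal.ofReal (1 - δ) ≤ nr2avgLaw D O cS cT d α ε δ
      {h | ∀ i : Fin k, expectedErr (D i) (nr2avgOutput O h) ≤ (1 + α) * opt D F + ε} := by
  set a := innerAlpha α with ha_def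
  set e := innerEps ε with he_def
  set t := rounds k α ε δ with ht_def
  have hα0 : 0 < α := by linarith
  have ha : 0 < a := by rw [ha_def, innerAlpha]; positivity
  have he : 0 < e := by rw [he_def, innerEps]; positivity
  have ha1 : a ≤ 1 / 15 := by rw [ha_def, innerAlpha]; linarith
  have he1 : e ≤ 1 / 29 := by rw [he_def, innerEps]; linarith
  have hea : e ≤ a := by rw [ha_def, he_def, innerAlpha, innerEps]; linarith
  have ht : 0 < t := rounds_pos hk hδ hδ1 hε hα0
  have ht' : (1 : ℝ) ≤ t := by exact_mod_cast ht
  have hk' : (1 : ℝ) ≤ k := by exact_mod_cast hk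
  have hδ' : 0 < innerDelta k α ε δ := by unfold innerDelta; positivity
  have hδ'1 : innerDelta k α ε δ ≤ 1 / 3 := by
    rw [innerDelta, div_le_iff₀ (by positivity)]
    nlinarith
  obtain ⟨hn, hnae, hfail⟩ := round_failure_le (d := d) hea he (by linarith) hδ' hδ'1 hcS
    (Nat.le_ceil (cS / (a * e) * (d * Real.log (1 / e) + Real.log (1 / innerDelta k α ε δ))))
  have hT : 0 < sizeT cT α ε := by
    apply Nat.ceil_pos.2
    rw [← ha_def, ← he_def]
    have : 0 < Real.log (1 / e) := Real.log_pos (by rw [lt_div_iff₀ he]; linarith)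
    positivity
  -- The infimum in `OPT` need not be attained; the extra `e` is already included in
  -- `error_bound_le`.
  obtain ⟨f, hf, hq⟩ := exists_err_le_opt_add D hne he
  have hmain := runLaw_average_err_le (nS := sizeS cS d k α ε δ) (nT := sizeT cT α ε)
    (θ := (1 + a) * (opt D F + e) + e) (D := D) hO ha (by linarith) he hk hT
    (η := 2 * innerDelta k α ε δ) (by positivity)
    (fun r h => (measureReal_not_accurateRound_le hd hF hERM hO ha (by linarith) he (by linarith)
      hn hnae hf hq (fun i => (weight_pos ha he r h i).le) (sum_weight_pos ha he hk r h)).trans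
      hfail) ht (M := 4 * k / δ) (by positivity) (log_le_rounds hε hα0)
  -- Half of `δ` goes to the accuracy of the rounds and a quarter to each potential.
  have hδeq : (t : ℝ) * (2 * innerDelta k α ε δ) + 2 * (k / (4 * k / δ)) = δ := by
    rw [innerDelta, ← ht_def]
    field_simp
    ring
  rw [hδeq] at hmain
  refine hmain.trans (measure_mono fun h hh i => ?_)
  have hfm : ∀ r, Measurable (roundClassifier O (h r)) := fun r => hF _ (hERM _ _).1
  rw [nr2avgOutput, expectedErr_mixClassifier (D i) hfm]
  refine (hh i).trans ((error_bound_le ha.le ha1 he.le (opt_nonneg D F)).trans_eq ?_)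
  rw [ha_def, he_def, innerAlpha, innerEps]
  ring

/-! ### The number of samples -/

/-- Since `k / δ ≥ 2`, its logarithm is at least `log 2 > 1 / 2`; it therefore absorbs the factor
`4` (total `3`) and the rounding up (another `2`), and the leading factor `2` gives `10`. -/
theorem rounds_le (hk : 2 * δ ≤ k) (hδ : 0 < δ) (hε : 0 < ε) (hε1 : ε < 1) (hα : 0 < α)
    (hα1 : α < 1) :
    (rounds k α ε δ : ℝ) ≤ 10 * Real.log (k / δ) / (innerEps ε * innerAlpha α ^ 2) := by
  have hpos : 0 < innerEps ε * innerAlpha α ^ 2 := by unfold innerEps innerAlpha; positivity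
  have hle : innerEps ε * innerAlpha α ^ 2 ≤ 1 := by
    have h1 : innerEps ε ≤ 1 := by unfold innerEps; linarith
    have h2 : innerAlpha α ^ 2 ≤ 1 := pow_le_one₀ (by unfold innerAlpha; positivity)
      (by unfold innerAlpha; linarith)
    exact mul_le_one₀ h1 (sq_nonneg _) h2
  have hkδ : 2 ≤ k / δ := by rwa [le_div_iff₀ hδ]
  have hQ : Real.log 2 ≤ Real.log (k / δ) := Real.log_le_log (by norm_num) hkδ
  have h4 : Real.log (4 * k / δ) = 2 * Real.log 2 + Real.log (k / δ) := by
    rw [mul_div_assoc, Real.log_mul (by norm_num) (by linarith),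
      show (4 : ℝ) = 2 ^ 2 by norm_num, Real.log_pow]
    norm_num
  have hl2 := Real.log_two_gt_d9
  have hc := Nat.ceil_lt_add_one (a := Real.log (4 * k / δ) / (innerEps ε * innerAlpha α ^ 2))
    (div_nonneg (by rw [h4]; linarith) hpos.le)
  have h1 : (1 : ℝ) ≤ 2 * Real.log (k / δ) / (innerEps ε * innerAlpha α ^ 2) := by
    rw [le_div_iff₀ hpos]; linarith
  have h2 : Real.log (4 * k / δ) / (innerEps ε * innerAlpha α ^ 2) ≤
      3 * Real.log (k / δ) / (innerEps ε * innerAlpha α ^ 2) := by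
    gcongr; linarith
  unfold rounds
  push_cast
  have h3 : 10 * Real.log (k / δ) / (innerEps ε * innerAlpha α ^ 2) =
      2 * (3 * Real.log (k / δ) / (innerEps ε * innerAlpha α ^ 2) +
        2 * Real.log (k / δ) / (innerEps ε * innerAlpha α ^ 2)) := by ring
  rw [h3]
  linarith

theorem two_le_log_inv_innerEps (hε : 0 < ε) (hε1 : ε < 1) :
    2 ≤ Real.log (1 / innerEps ε) := by
  rw [Real.le_log_iff_exp_le (by unfold innerEps; positivity), innerEps, one_div_div,
    le_div_iff₀ hε, show (2 : ℝ) = 1 + 1 by norm_num, Real.exp_add]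
  nlinarith [Real.exp_one_lt_d9, Real.exp_pos (1 : ℝ)]

/-- The number of rounds enters `1 / δ'` only through its logarithm: the powers of `1 / a` and `1 /
e` give multiples of `log (1 / e)`, using `e ≤ a`. -/
theorem log_inv_innerDelta_le (hk : 1 ≤ k) (hkδ : 2 * δ ≤ k) (hδ : 0 < δ) (hδ1 : δ < 1)
    (hε : 0 < ε) (hε1 : ε < 1) (hα : 30 * ε / 29 < α) (hα1 : α < 1) :
    Real.log (1 / innerDelta k α ε δ) ≤
      6 * k * Real.log (1 / innerEps ε) + 2 * Real.log (1 / δ) := by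
  have hα0 : 0 < α := by linarith
  have ha : 0 < innerAlpha α := by unfold innerAlpha; positivity
  have he : 0 < innerEps ε := by unfold innerEps; positivity
  have hea : innerEps ε ≤ innerAlpha α := by unfold innerAlpha innerEps; linarith
  have hk' : (1 : ℝ) ≤ k := by exact_mod_cast hk
  have hkδ' : 2 ≤ k / δ := by rwa [le_div_iff₀ hδ]
  have ht := rounds_pos hk hδ hδ1 hε hα0
  have ht' : (0 : ℝ) < rounds k α ε δ := by exact_mod_cast ht
  have hQ : 0 < Real.log (k / δ) := Real.log_pos (by linarith)
  have hL := two_le_log_inv_innerEps hε hε1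
  have h1 : 1 / innerDelta k α ε δ ≤
      40 * (Real.log (k / δ) * ((1 / innerEps ε) ^ 3 * (1 / δ))) := by
    have h2 := rounds_le hkδ hδ hε hε1 hα0 hα1
    have h3 : 10 * Real.log (k / δ) / (innerEps ε * innerAlpha α ^ 2) ≤
        10 * Real.log (k / δ) / (innerEps ε * innerEps ε ^ 2) := by gcongr
    have h4 : 1 / innerDelta k α ε δ = 4 * rounds k α ε δ * (1 / δ) := by
      rw [innerDelta, one_div_div]; ring
    have h5 : 40 * (Real.log (k / δ) * ((1 / innerEps ε) ^ 3 * (1 / δ))) =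
        4 * (10 * Real.log (k / δ) / (innerEps ε * innerEps ε ^ 2)) * (1 / δ) := by
      field_simp; ring
    rw [h4, h5]
    gcongr
    exact h2.trans h3
  have h6 := Real.log_le_log (by unfold innerDelta; positivity) h1
  rw [Real.log_mul (by norm_num) (by positivity), Real.log_mul hQ.ne' (by positivity),
    Real.log_mul (by positivity) (by positivity), Real.log_pow] at h6
  have h7 : Real.log 40 ≤ 2 * Real.log (1 / innerEps ε) := by
    have h29 : Real.log 29 ≤ Real.log (1 / innerEps ε) := by
      apply Real.log_le_log (by norm_num)
      rw [innerEps, one_div_div, le_div_iff₀ hε]; linarith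
    have : Real.log 40 ≤ Real.log (29 ^ 2) := Real.log_le_log (by norm_num) (by norm_num)
    rw [Real.log_pow] at this
    push_cast at this
    linarith
  -- This crude bound suffices, because the target already contains `k * log (1 / ε)`.
  have h8 : Real.log (Real.log (k / δ)) ≤ k + Real.log (1 / δ) := by
    have h9 := Real.log_le_sub_one_of_pos hQ
    have h10 := Real.log_le_sub_one_of_pos (show (0 : ℝ) < k by linarith)
    have h11 : Real.log (k / δ) = Real.log k + Real.log (1 / δ) := by
      rw [div_eq_mul_one_div, Real.log_mul (by positivity) (by positivity)]
    linarith
  push_cast at h6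
  nlinarith [mul_le_mul_of_nonneg_right hk' (by linarith : 0 ≤ Real.log (1 / innerEps ε))]

theorem nr2avgSamples_le {cS cT : ℝ} (hcS : 0 < cS) (hcT : 0 < cT) {d : ℕ} (hk : 1 ≤ k)
    (hkδ : 2 * δ ≤ k) (hδ : 0 < δ) (hδ1 : δ < 1) (hε : 0 < ε) (hε1 : ε < 1)
    (hα : 30 * ε / 29 < α) (hα1 : α < 1) :
    (nr2avgSamples cS cT d k α ε δ : ℝ) ≤
      10 * (6 * cS + cT + 2) * (1 + Real.log 29 / Real.log (30 / 29)) * (15 ^ 3 * 29 ^ 2) *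
        (1 / (α ^ 3 * ε ^ 2) * Real.log (k / δ) *
          ((d + k) * Real.log (1 / ε) + Real.log (1 / δ))) := by
  have hα0 : 0 < α := by linarith
  set a := innerAlpha α with ha_def
  set e := innerEps ε with he_def
  have ha : 0 < a := by rw [ha_def, innerAlpha]; positivity
  have he : 0 < e := by rw [he_def, innerEps]; positivity
  have hae1 : a * e ≤ 1 := mul_le_one₀ (by rw [ha_def, innerAlpha]; linarith) he.le
    (by rw [he_def, innerEps]; linarith)
  have hk' : (1 : ℝ) ≤ k := by exact_mod_cast hk
  have hL := two_le_log_inv_innerEps hε hε1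
  rw [← he_def] at hL
  have hδL : 0 ≤ Real.log (1 / δ) := Real.log_nonneg (by rw [le_div_iff₀ hδ]; linarith)
  have hQ : 0 ≤ Real.log (k / δ) := Real.log_nonneg (by rw [le_div_iff₀ hδ]; linarith)
  have hΔ := log_inv_innerDelta_le hk hkδ hδ hδ1 hε hε1 hα hα1
  rw [← he_def] at hΔ
  have hd0 : (0 : ℝ) ≤ d := Nat.cast_nonneg d
  set Y := (d + k) * Real.log (1 / e) + Real.log (1 / δ) with hY
  have hdL : 0 ≤ d * Real.log (1 / e) := by positivity
  have hkL : k ≤ k * Real.log (1 / e) := le_mul_of_one_le_right (by positivity) (by linarith)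
  have hY0 : 0 ≤ Y := by rw [hY]; positivity
  -- Pays for the roundings up in the sample sizes: one for the mixture and one for each player.
  have hkY : (k : ℝ) ≤ 1 / (a * e) * Y := by
    have h1 : (k : ℝ) ≤ Y := by rw [hY]; linarith
    have h2 : 1 ≤ 1 / (a * e) := by rw [le_div_iff₀ (by positivity)]; linarith
    nlinarith
  have hδ' : 0 ≤ Real.log (1 / innerDelta k α ε δ) := by
    have ht : (1 : ℝ) ≤ rounds k α ε δ := by exact_mod_cast rounds_pos hk hδ hδ1 hε hα0
    apply Real.log_nonneg
    rw [innerDelta, one_div_div, le_div_iff₀ hδ]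
    linarith
  have hS : (sizeS cS d k α ε δ : ℝ) ≤ (6 * cS + 1) * (1 / (a * e) * Y) := by
    refine (Nat.ceil_lt_add_one (mul_nonneg (div_nonneg hcS.le (by positivity))
      (add_nonneg ?_ hδ'))).le.trans ?_
    · exact hdL
    rw [← ha_def, ← he_def]
    have h1 : d * Real.log (1 / e) + Real.log (1 / innerDelta k α ε δ) ≤ 6 * Y := by
      rw [hY]; linarith
    have h2 : cS / (a * e) * (d * Real.log (1 / e) + Real.log (1 / innerDelta k α ε δ)) ≤
        cS / (a * e) * (6 * Y) := by gcongr
    have h3 : cS / (a * e) * (6 * Y) = 6 * cS * (1 / (a * e) * Y) := by ring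
    linarith
  have hT : k * (sizeT cT α ε : ℝ) ≤ (cT + 1) * (1 / (a * e) * Y) := by
    have h1 := (Nat.ceil_lt_add_one (a := cT / (a * e) * Real.log (1 / e)) (by positivity)).le
    have h2 : (sizeT cT α ε : ℝ) ≤ cT / (a * e) * Real.log (1 / e) + 1 := h1
    have h3 : k * Real.log (1 / e) ≤ Y := by rw [hY]; linarith
    calc k * (sizeT cT α ε : ℝ) ≤ k * (cT / (a * e) * Real.log (1 / e) + 1) := by gcongr
      _ = cT / (a * e) * (k * Real.log (1 / e)) + k := by ring
      _ ≤ cT / (a * e) * Y + 1 / (a * e) * Y := by gcongr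
      _ = _ := by ring
  have hl0 : 0 < Real.log (30 / 29) := Real.log_pos (by norm_num)
  have h29 : 0 < Real.log 29 := Real.log_pos (by norm_num)
  -- The assumptions `30 ε / 29 < α < 1` keep `ε` below `29 / 30`, so `log (1 / ε)` is bounded away
  -- from zero and can absorb the `log 29` that comes from `ε' = ε / 29`.
  have hLε : Real.log (30 / 29) ≤ Real.log (1 / ε) := by
    apply Real.log_le_log (by norm_num)
    rw [le_div_iff₀ hε]; linarith
  set C := 1 + Real.log 29 / Real.log (30 / 29) with hC
  have hC1 : 1 ≤ C := by
    have : 0 ≤ Real.log 29 / Real.log (30 / 29) := by positivity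
    linarith
  have hLe : Real.log (1 / e) ≤ C * Real.log (1 / ε) := by
    have h1 : Real.log (1 / e) = Real.log 29 + Real.log (1 / ε) := by
      rw [he_def, innerEps, one_div_div, div_eq_mul_one_div,
        Real.log_mul (by norm_num) (by positivity)]
    have h2 : Real.log 29 ≤ Real.log 29 / Real.log (30 / 29) * Real.log (1 / ε) := by
      rw [div_mul_eq_mul_div, le_div_iff₀ hl0]
      gcongr
    rw [h1, hC]
    linarith
  have hYZ : Y ≤ C * ((d + k) * Real.log (1 / ε) + Real.log (1 / δ)) := by
    rw [hY]
    have : (d + k) * Real.log (1 / e) ≤ (d + k) * (C * Real.log (1 / ε)) := by gcongr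
    nlinarith
  have hR := rounds_le hkδ hδ hε hε1 hα0 hα1
  rw [← ha_def, ← he_def] at hR
  unfold nr2avgSamples
  push_cast
  calc (rounds k α ε δ : ℝ) * (sizeS cS d k α ε δ + k * sizeT cT α ε)
      ≤ 10 * Real.log (k / δ) / (e * a ^ 2) * ((6 * cS + cT + 2) * (1 / (a * e) *
        (C * ((d + k) * Real.log (1 / ε) + Real.log (1 / δ))))) := by
        refine mul_le_mul hR ?_ (by positivity) (by positivity)
        calc _ ≤ (6 * cS + cT + 2) * (1 / (a * e) * Y) := by linarith
          _ ≤ _ := by gcongr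
    _ = _ := by
        rw [ha_def, he_def, innerAlpha, innerEps]
        field_simp

end

/-! ### The main theorem -/

theorem theorem6 :
    ∃ c₀ : ℝ, 0 < c₀ ∧ ∀ cS cT : ℝ, c₀ ≤ cS → c₀ ≤ cT →
      ∃ K : ℝ, 0 < K ∧
        ∀ (X : Type*) [MeasurableSpace X] (F : Set (X → Bool)) (d : ℕ)
          (O : ∀ n : ℕ, Sample X n → X → Bool) (k : ℕ) (D : Fin k → Measure (X × Bool))
          [∀ i, IsProbabilityMeasure (D i)] (α ε δ : ℝ),
          F.Nonempty → (∀ f ∈ F, Measurable f) → vcDim F = d →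
          IsERM F O →
          (∀ n : ℕ, Measurable fun p : Sample X n × X => O n p.1 p.2) →
          1 ≤ k → 0 < ε → ε < 1 → 0 < δ → δ < 1 → 30 * ε / 29 < α → α < 1 →
          ENNReal.ofReal (1 - δ) ≤ nr2avgLaw D O cS cT d α ε δ
              {h | ∀ i : Fin k, expectedErr (D i) (nr2avgOutput O h) ≤ (1 + α) * opt D F + ε} ∧
          (2 * δ ≤ k →
            (nr2avgSamples cS cT d k α ε δ : ℝ) ≤
              K * (1 / (α ^ 3 * ε ^ 2) * Real.log (k / δ) *
                ((d + k) * Real.log (1 / ε) + Real.log (1 / δ)))) := by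
  -- The value `24` is dictated by `round_failure_le` for the mixture samples; of `cT` only
  -- positivity is used.
  refine ⟨24, by norm_num, fun cS cT hcS hcT => ⟨10 * (6 * cS + cT + 2) *
    (1 + Real.log 29 / Real.log (30 / 29)) * (15 ^ 3 * 29 ^ 2), ?_, ?_⟩⟩
  · have h1 : 0 < Real.log (30 / 29) := Real.log_pos (by norm_num)
    have h2 : 0 < Real.log 29 := Real.log_pos (by norm_num)
    have h3 : 0 < 6 * cS + cT + 2 := by linarith
    positivity
  · intro X _ F d O k D _ α ε δ hne hF hd hERM hO hk hε hε1 hδ hδ1 hα hα1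
    exact ⟨nr2avg_error hcS (by linarith) hne hF hd.le hERM hO hk hε hδ hδ1 hα hα1,
      fun hkδ => nr2avgSamples_le (by linarith) (by linarith) hk hkδ hδ hδ1 hε hε1 hα hα1⟩
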